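/- Let $K\subset\mathbb{R}^n$ be a nonempty closed convex set, let $\Pi_K(x)=\operatorname{argmin}_{q\in K}\|x-q\|^2$ be the (Euclidean) projection onto $K$, let $\mu_0\in\mathbb{R}^n$ and let $h\sim\mathcal{N}(0,I_n)$. For $\sigma>0$ let $\hat\mu_K(\sigma)=\operatorname{argmin}_{\mu\in K}\|\mu_0+\sigma h-\mu\|^2=\Pi_K(\mu_0+\sigma h)$ be the constrained least squares estimator in the Gaussian sequence model and $\mathrm{err}(\sigma)=\|\hat\mu_K(\sigma)-\mu_0\|^2$. For a nonempty closed convex set $C\subset\mathbb{R}^n$ let $\delta_C=\lim_{\sigma\uparrow\infty}\mathbb{E}\|\Pi_C(\sigma h)\|^2/\sigma^2$, and for $\mu_0\in K$ let $T_K(\mu_0)=\mathrm{cl}\{\alpha(\nu-\mu_0):\alpha\ge 0,\ \nu\in K\}$ be the tangent cone of $K$ at $\mu_0$. Then the following hold. 1. Suppose $\mu_0\in K$. For every realization of $h$, the limit $\lim_{\tau\uparrow\infty}\|\Pi_K(\tau h)\|^2/\tau^2$ exists, and for all $\sigma>0$ $$\lim_{\tau\uparrow\infty}\frac{\|\Pi_K(\tau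 h)\|^2}{\tau^2}\le\frac{\mathrm{err}(\sigma)}{\sigma^2}\le\|h\|^2 .$$ The lower bound is attained in the limit: $\lim_{\sigma\uparrow\infty}\mathrm{err}(\sigma)/\sigma^2=\lim_{\tau\uparrow\infty}\|\Pi_K(\tau h)\|^2/\tau^2$. The limits defining $\delta_K$ and $\delta_{T_K(\mu_0)}$ exist (with finite expectations), and $$\lim_{\sigma\uparrow\infty}\frac{\mathbb{E}\,\mathrm{err}(\sigma)}{\sigma^2}=\delta_K,\qquad \lim_{\sigma\downarrow0}\frac{\mathbb{E}\,\mathrm{err}(\sigma)}{\sigma^2}=\delta_{T_K(\mu_0)} .$$ Consequently $\delta_K\le\delta_{T_K(\mu_0)}$. 2. For all $\sigma>0$, $\mathrm{err}(\sigma)$ is square integrable and $\mathrm{Var}(\mathrm{err}(\sigma))\le 4\sigma^2\,\mathbb{E}\,\mathrm{err}(\sigma)$. 3. For all $\sigma>0$ and all real $\lambda<1/(2\sigma^2)$, $$\mathbb{E}\exp\big(\lambda(\mathrm{err}(\sigma)-\mathbb{E}\,\mathrm{err}(\sigma))\big)\le\exp\Big(\frac{2\sigma^2\lambda^2\,\mathbb{E}\,\mathrm{err}(\sigma)}{1-2\sigma^2\lambda}\Big)$$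 (in particular the left-hand side is finite). Consequently, for all $t\ge0$, $$\mathbb{P}\Big(\big|\mathrm{err}(\sigma)-\mathbb{E}\,\mathrm{err}(\sigma)\big|\ge\sqrt{8\sigma^2\,\mathbb{E}\,\mathrm{err}(\sigma)\,t}+2\sigma^2t\Big)\le 2e^{-t}.$$ -/

import Mathlib

open MeasureTheory ProbabilityTheory Filter Topology

noncomputable section

/-- `p` minimizes `q ↦ ‖x - q‖²` over `K`. -/
def IsProjOn {n : ℕ} (K : Set (EuclideanSpace ℝ (Fin n))) (x p : EuclideanSpace ℝ (Fin n)) :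
    Prop :=
  p ∈ K ∧ ∀ q ∈ K, ‖x - p‖ ^ 2 ≤ ‖x - q‖ ^ 2

/-- The projection `Π_K(x) = argmin_{q ∈ K} ‖x - q‖²`. For nonempty closed convex `K` the minimizer
exists and is unique, see `existsUnique_isProjOn` and `convexProj_spec`. -/
def convexProj {n : ℕ} (K : Set (EuclideanSpace ℝ (Fin n))) (x : EuclideanSpace ℝ (Fin n)) :
    EuclideanSpace ℝ (Fin n) :=
  Classical.epsilon (IsProjOn K x)

theorem existsUnique_isProjOn {n : ℕ} {K : Set (EuclideanSpace ℝ (Fin n))} (hne : K.Nonempty)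
    (hcl : IsClosed K) (hcv : Convex ℝ K) (x : EuclideanSpace ℝ (Fin n)) :
    ∃! p, IsProjOn K x p := by
  obtain ⟨v, hv, hmin⟩ := exists_norm_eq_iInf_of_complete_convex hne hcl.isComplete hcv x
  have hvar := (norm_eq_iInf_iff_real_inner_le_zero hcv hv).1 hmin
  have key : ∀ q ∈ K, ‖x - v‖ ^ 2 + ‖q - v‖ ^ 2 ≤ ‖x - q‖ ^ 2 := by
    intro q hq
    have h1 := hvar q hq
    have h2 := norm_sub_sq_real (x - v) (q - v)
    rw [sub_sub_sub_cancel_right] at h2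
    linarith
  refine ⟨v, ⟨hv, fun q hq => ?_⟩, ?_⟩
  · nlinarith [key q hq, sq_nonneg ‖q - v‖]
  · rintro p ⟨hp, hpm⟩
    have h1 := key p hp
    have h2 := hpm v hv
    have h3 : ‖p - v‖ ^ 2 = 0 := le_antisymm (by linarith) (sq_nonneg _)
    exact sub_eq_zero.1 (norm_eq_zero.1 (pow_eq_zero_iff (two_ne_zero) |>.1 h3))

theorem convexProj_spec {n : ℕ} {K : Set (EuclideanSpace ℝ (Fin n))} (hne : K.Nonempty)
    (hcl : IsClosed K) (hcv : Convex ℝ K) (x : EuclideanSpace ℝ (Fin n)) :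
    IsProjOn K x (convexProj K x) :=
  Classical.epsilon_spec (existsUnique_isProjOn hne hcl hcv x).exists

/-- The constrained least squares estimator `argmin_{μ ∈ K} ‖y - μ‖²` in the Gaussian sequence
model `y = μ₀ + σ h`, as a function of the noise vector `h`. -/
def seqLSE {n : ℕ} (K : Set (EuclideanSpace ℝ (Fin n))) (μ₀ : EuclideanSpace ℝ (Fin n)) (σ : ℝ)
    (h : EuclideanSpace ℝ (Fin n)) : EuclideanSpace ℝ (Fin n) :=
  convexProj K (μ₀ + σ • h)

/-- The squared estimation error `err_{(K,μ₀)}(σ) = ‖μ̂_K(σ) - μ₀‖²`. -/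
def seqErr {n : ℕ} (K : Set (EuclideanSpace ℝ (Fin n))) (μ₀ : EuclideanSpace ℝ (Fin n)) (σ : ℝ)
    (h : EuclideanSpace ℝ (Fin n)) : ℝ :=
  ‖seqLSE K μ₀ σ h - μ₀‖ ^ 2

/-- `E ‖Π_K(σ h)‖² / σ²` for `h ∼ N(0, I_n)`. -/
def scaledProjRisk {n : ℕ} (K : Set (EuclideanSpace ℝ (Fin n))) (σ : ℝ) : ℝ :=
  (∫ x, ‖convexProj K (σ • x)‖ ^ 2 ∂(stdGaussian (EuclideanSpace ℝ (Fin n)))) / σ ^ 2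

/-- The generalized statistical dimension `δ_K = lim_{σ → ∞} E ‖Π_K(σ h)‖² / σ²`. -/
def genStatDim {n : ℕ} (K : Set (EuclideanSpace ℝ (Fin n))) : ℝ :=
  limUnder atTop (scaledProjRisk K)

/-- The tangent cone `T_K(μ₀) = cl {α (ν - μ₀) : α ≥ 0, ν ∈ K}`. -/
def tangentConeOf {n : ℕ} (K : Set (EuclideanSpace ℝ (Fin n))) (μ₀ : EuclideanSpace ℝ (Fin n)) :
    Set (EuclideanSpace ℝ (Fin n)) :=
  closure {v | ∃ α : ℝ, 0 ≤ α ∧ ∃ ν ∈ K, v = α • (ν - μ₀)}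

end

/-! Two ingredients carry the proof: monotonicity in `σ` and a Gaussian transport inequality.

For a path `x`, put `a` and `b` for the displacements of the estimator from `μ` at noise levels `s ≤
t`. The variational inequalities of the two projections, weighted by `t` and `s`, cancel the noise
and leave `(s‖b‖ - t‖a‖)(‖b‖ - ‖a‖) ≤ 0`; hence displacement over `σ` is nonincreasing
(`mul_norm_seqLSE_sub_le`). Its limit at infinity does not depend on `μ`, since projections are
1-Lipschitz. At zero, the rescaled displacement is the projection of `x` on `σ⁻¹(K - μ₀)`, and these
sets fill out the tangent cone. Dominated convergence passes both limits to the risk, and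
monotonicity compares them.

For concentration, `f = ‖seqLSE - μ₀‖` is `σ`-Lipschitz in the noise. Prékopa–Leindler for the
Gaussian measure, combined with Jensen, gives `∫ e^u ≤ e^(∫ g)` whenever `u x ≤ g y + s‖x - y‖²/2`
with `s < 1` (`lintegral_exp_le_of_le_add_sq`). Taking multiples of `f²` for `u` and `g` and letting
`s → 1` bounds `E exp(λ f²)` for every `λ < 1/(2σ²)`, of either sign. After centering this is a
sub-gamma bound with `c = 2σ²` and `a = c · E f²`; variance and both tails follow from it alone. -/

open scoped ENNReal Pointwise

/-! ### Brunn–Minkowski and Prékopa–Leindler on the line -/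

/-- The Brunn–Minkowski inequality on the line, for compact sets. -/
theorem volume_add_le_of_isCompact {A B C : Set ℝ} (hA : IsCompact A) (hB : IsCompact B)
    (hAne : A.Nonempty) (hBne : B.Nonempty) (hC : ∀ a ∈ A, ∀ b ∈ B, a + b ∈ C) :
    volume A + volume B ≤ volume C := by
  -- With `a` the greatest point of `A` and `b` the least of `B`, the translates `A + b` and `a + B`
  -- lie in `C` and meet only at `a + b`.
  obtain ⟨b, hb, hbmin⟩ := hB.exists_isLeast hBne
  obtain ⟨a, ha, hamax⟩ := hA.exists_isGreatest hAne
  have h1 : volume ((fun x => x + b) '' A) = volume A := by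
    simp [Set.image_add_right]
  have h2 : volume ((fun x => a + x) '' B) = volume B := by
    simp [Set.image_add_left]
  have hinter : volume ((fun x => x + b) '' A ∩ (fun x => a + x) '' B) = 0 := by
    refine measure_mono_null (t := {a + b}) ?_ (by simp)
    rintro z ⟨⟨x, hx, rfl⟩, ⟨y, hy, hxy⟩⟩
    have := hamax hx
    have := hbmin hy
    simp only [Set.mem_singleton_iff] at *
    linarith
  have hmeas : MeasurableSet ((fun x => a + x) '' B) :=
    (hB.image (continuous_const.add continuous_id)).measurableSet
  have := measure_union_add_inter (μ := volume) ((fun x => x + b) '' A) hmeas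
  rw [hinter, add_zero, h1, h2] at this
  rw [← this]
  refine measure_mono (Set.union_subset ?_ ?_)
  · rintro _ ⟨x, hx, rfl⟩
    exact hC x hx b hb
  · rintro _ ⟨x, hx, rfl⟩
    exact hC a ha x hx

/-- The Brunn–Minkowski inequality on the line. -/
theorem volume_add_le_of_measurableSet {A B C : Set ℝ} (hA : MeasurableSet A)
    (hB : MeasurableSet B) (hAne : A.Nonempty) (hBne : B.Nonempty)
    (hC : ∀ a ∈ A, ∀ b ∈ B, a + b ∈ C) : volume A + volume B ≤ volume C := by
  obtain ⟨a, ha⟩ := hAne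
  obtain ⟨b, hb⟩ := hBne
  have key : ∀ K : Set ℝ, K ⊆ A ∧ IsCompact K → ∀ L : Set ℝ, L ⊆ B ∧ IsCompact L →
      volume K + volume L ≤ volume C := by
    rintro K ⟨hKA, hK⟩ L ⟨hLB, hL⟩
    -- The approximating compact sets may be empty, where the compact case fails; inserting a point
    -- repairs this.
    have hKA' : insert a K ⊆ A := Set.insert_subset ha hKA
    have hLB' : insert b L ⊆ B := Set.insert_subset hb hLB
    calc volume K + volume L ≤ volume (insert a K) + volume (insert b L) :=
          add_le_add (measure_mono (Set.subset_insert _ _)) (measure_mono (Set.subset_insert _ _))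
      _ ≤ volume C := volume_add_le_of_isCompact (hK.insert a) (hL.insert b)
          (Set.insert_nonempty _ _) (Set.insert_nonempty _ _)
          fun x hx y hy => hC x (hKA' hx) y (hLB' hy)
  have h := ENNReal.biSup_add_biSup_le' (p := fun K : Set ℝ => K ⊆ A ∧ IsCompact K)
    (q := fun L : Set ℝ => L ⊆ B ∧ IsCompact L) ⟨∅, by simp⟩ ⟨∅, by simp⟩ key
  rw [hA.measure_eq_iSup_isCompact, hB.measure_eq_iSup_isCompact]
  simpa only [iSup_and] using h

theorem volume_convexComb_le {A B C : Set ℝ} {t s : ℝ} (ht : 0 < t) (hs : 0 < s)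
    (hA : MeasurableSet A) (hB : MeasurableSet B) (hAne : A.Nonempty) (hBne : B.Nonempty)
    (hC : ∀ a ∈ A, ∀ b ∈ B, t * a + s * b ∈ C) :
    ENNReal.ofReal t * volume A + ENNReal.ofReal s * volume B ≤ volume C := by
  have h := volume_add_le_of_measurableSet (hA.const_smul₀ t) (hB.const_smul₀ s)
    (hAne.smul_set (a := t)) (hBne.smul_set (a := s)) (C := C) (by
      rintro _ ⟨a, ha, rfl⟩ _ ⟨b, hb, rfl⟩
      exact hC a ha b hb)
  simpa [Measure.addHaar_smul, abs_of_pos ht, abs_of_pos hs] using h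

theorem lintegral_eq_lintegral_volume_lt {f : ℝ → ℝ≥0∞} (hf : Measurable f)
    (hf1 : ∀ x, f x ≤ 1) :
    ∫⁻ x, f x = ∫⁻ r in Set.Ioi (0 : ℝ), volume {x | ENNReal.ofReal r < f x} := by
  have hfin : ∀ x, f x ≠ ∞ := fun x => ne_top_of_le_ne_top ENNReal.one_ne_top (hf1 x)
  have h := lintegral_eq_lintegral_meas_lt (volume : Measure ℝ) (f := fun x => (f x).toReal)
    (ae_of_all _ fun x => ENNReal.toReal_nonneg) hf.ennreal_toReal.aemeasurable
  simp only [ENNReal.ofReal_toReal (hfin _)] at h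
  rw [h]
  refine setLIntegral_congr_fun measurableSet_Ioi fun r hr => ?_
  simp only [ENNReal.ofReal_lt_iff_lt_toReal (le_of_lt (Set.mem_Ioi.1 hr)) (hfin _)]

/-- The additive form of the Prékopa–Leindler inequality for functions with supremum one. -/
theorem prekopaLeindler_of_iSup_eq_one {t s : ℝ} (ht : 0 < t) (hs : 0 < s) (hts : t + s = 1)
    {f g h : ℝ → ℝ≥0∞} (hf : Measurable f) (hg : Measurable g) (hh : Measurable h)
    (hf1 : ⨆ x, f x = 1) (hg1 : ⨆ x, g x = 1)
    (hfgh : ∀ x y, f x ^ t * g y ^ s ≤ h (t * x + s * y)) :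
    ENNReal.ofReal t * (∫⁻ x, f x) + ENNReal.ofReal s * ∫⁻ x, g x ≤ ∫⁻ x, h x := by
  have hf1' : ∀ x, f x ≤ 1 := fun x => hf1 ▸ le_iSup f x
  have hg1' : ∀ x, g x ≤ 1 := fun x => hg1 ▸ le_iSup g x
  have hmin : Measurable fun x => min (h x) 1 := hh.min measurable_const
  calc ENNReal.ofReal t * (∫⁻ x, f x) + ENNReal.ofReal s * ∫⁻ x, g x
      ≤ ∫⁻ r in Set.Ioi (0 : ℝ), (ENNReal.ofReal t * volume {x | ENNReal.ofReal r < f x}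
          + ENNReal.ofReal s * volume {x | ENNReal.ofReal r < g x}) := by
        rw [lintegral_eq_lintegral_volume_lt hf hf1', lintegral_eq_lintegral_volume_lt hg hg1']
        exact (add_le_add (lintegral_const_mul_le _ _) (lintegral_const_mul_le _ _)).trans
          (le_lintegral_add _ _)
    _ ≤ ∫⁻ r in Set.Ioi (0 : ℝ), volume {x | ENNReal.ofReal r < min (h x) 1} := by
        refine setLIntegral_mono' measurableSet_Ioi fun r hr => ?_
        rcases lt_or_ge (ENNReal.ofReal r) 1 with hr1 | hr1
        -- Both suprema being one, the level sets at every `r < 1` are nonempty, so Brunn–Minkowski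
        -- applies at each level.
        · have hfr : ∃ x, ENNReal.ofReal r < f x := lt_iSup_iff.1 (hf1 ▸ hr1)
          have hgr : ∃ x, ENNReal.ofReal r < g x := lt_iSup_iff.1 (hg1 ▸ hr1)
          refine volume_convexComb_le ht hs (measurableSet_lt measurable_const hf)
            (measurableSet_lt measurable_const hg) hfr hgr fun a ha b hb => ?_
          refine lt_min (lt_of_lt_of_le ?_ (hfgh a b)) hr1
          have hsplit : ENNReal.ofReal r = ENNReal.ofReal r ^ t * ENNReal.ofReal r ^ s := by
            rw [← ENNReal.rpow_add_of_nonneg t s ht.le hs.le, hts, ENNReal.rpow_one]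
          rw [hsplit]
          exact ENNReal.mul_lt_mul (ENNReal.rpow_lt_rpow ha ht) (ENNReal.rpow_lt_rpow hb hs)
        · have e1 : {x | ENNReal.ofReal r < f x} = ∅ :=
            Set.eq_empty_of_forall_notMem fun x hx => not_lt.2 ((hf1' x).trans hr1) hx
          have e2 : {x | ENNReal.ofReal r < g x} = ∅ :=
            Set.eq_empty_of_forall_notMem fun x hx => not_lt.2 ((hg1' x).trans hr1) hx
          simp [e1, e2]
    _ = ∫⁻ x, min (h x) 1 :=
        (lintegral_eq_lintegral_volume_lt hmin fun x => min_le_right _ _).symm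
    _ ≤ ∫⁻ x, h x := lintegral_mono fun x => min_le_left _ _

theorem ENNReal.rpow_mul_rpow_le_add {t s : ℝ} (ht : 0 < t) (hs : 0 < s) (hts : t + s = 1)
    (a b : ℝ≥0∞) : a ^ t * b ^ s ≤ ENNReal.ofReal t * a + ENNReal.ofReal s * b := by
  have h := ENNReal.young_inequality (a ^ t) (b ^ s) (p := t⁻¹) (q := s⁻¹)
    ⟨by simpa using hts, by positivity, by positivity⟩
  rw [← ENNReal.rpow_mul, ← ENNReal.rpow_mul, mul_inv_cancel₀ ht.ne', mul_inv_cancel₀ hs.ne',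
    ENNReal.rpow_one, ENNReal.rpow_one, ENNReal.ofReal_inv_of_pos ht, ENNReal.ofReal_inv_of_pos hs,
    div_eq_mul_inv, div_eq_mul_inv, inv_inv, inv_inv] at h
  rwa [mul_comm (ENNReal.ofReal t), mul_comm (ENNReal.ofReal s)]

/-- The Prékopa–Leindler inequality on the line for bounded functions. -/
theorem prekopaLeindler_of_iSup_ne_top {t s : ℝ} (ht : 0 < t) (hs : 0 < s) (hts : t + s = 1)
    {f g h : ℝ → ℝ≥0∞} (hf : Measurable f) (hg : Measurable g) (hh : Measurable h)
    (hf1 : ⨆ x, f x ≠ ∞) (hg1 : ⨆ x, g x ≠ ∞)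
    (hfgh : ∀ x y, f x ^ t * g y ^ s ≤ h (t * x + s * y)) :
    (∫⁻ x, f x) ^ t * (∫⁻ x, g x) ^ s ≤ ∫⁻ x, h x := by
  set M := ⨆ x, f x with hM
  set N := ⨆ x, g x with hN
  rcases eq_or_ne M 0 with hM0 | hM0
  · have : ∀ x, f x = 0 := fun x => le_antisymm (hM0 ▸ le_iSup f x) bot_le
    simp [this, ht]
  rcases eq_or_ne N 0 with hN0 | hN0
  · have : ∀ x, g x = 0 := fun x => le_antisymm (hN0 ▸ le_iSup g x) bot_le
    simp [this, hs]
  -- Rescaling to supremum one gives the additive inequality; weighted AM–GM makes it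
  -- multiplicative, and the scale `c` then cancels.
  set c := (M⁻¹) ^ t * (N⁻¹) ^ s with hc
  have hc0 : c ≠ 0 := mul_ne_zero (by simp [hf1, hM0]) (by simp [hg1, hN0])
  have hct : c ≠ ∞ := ENNReal.mul_ne_top
    (ENNReal.rpow_ne_top_of_nonneg ht.le (ENNReal.inv_ne_top.2 hM0))
    (ENNReal.rpow_ne_top_of_nonneg hs.le (ENNReal.inv_ne_top.2 hN0))
  have key := prekopaLeindler_of_iSup_eq_one ht hs hts (hf.const_mul M⁻¹) (hg.const_mul N⁻¹)
    (hh.const_mul c) (by rw [← ENNReal.mul_iSup, ENNReal.inv_mul_cancel hM0 hf1])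
    (by rw [← ENNReal.mul_iSup, ENNReal.inv_mul_cancel hN0 hg1]) (by
      intro x y
      rw [ENNReal.mul_rpow_of_nonneg _ _ ht.le, ENNReal.mul_rpow_of_nonneg _ _ hs.le,
        mul_mul_mul_comm]
      exact mul_le_mul_right (hfgh x y) c)
  rw [lintegral_const_mul _ hf, lintegral_const_mul _ hg, lintegral_const_mul _ hh] at key
  have key2 := (ENNReal.rpow_mul_rpow_le_add ht hs hts _ _).trans key
  rw [ENNReal.mul_rpow_of_nonneg _ _ ht.le, ENNReal.mul_rpow_of_nonneg _ _ hs.le,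
    mul_mul_mul_comm] at key2
  exact (ENNReal.mul_le_mul_iff_right hc0 hct).1 key2

theorem lintegral_eq_iSup_lintegral_min {α : Type*} [MeasurableSpace α] {μ : Measure α}
    {f : α → ℝ≥0∞} (hf : Measurable f) :
    ∫⁻ x, f x ∂μ = ⨆ n : ℕ, ∫⁻ x, min (f x) n ∂μ := by
  rw [← lintegral_iSup (fun n => hf.min measurable_const)]
  · refine lintegral_congr fun x => ?_
    rw [← inf_iSup_eq, ENNReal.iSup_natCast, inf_top_eq]
  · intro m n hmn x
    exact min_le_min le_rfl (by exact_mod_cast hmn)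

/-- The Prékopa–Leindler inequality on the line. -/
theorem prekopaLeindler {t s : ℝ} (ht : 0 < t) (hs : 0 < s) (hts : t + s = 1)
    {f g h : ℝ → ℝ≥0∞} (hf : Measurable f) (hg : Measurable g) (hh : Measurable h)
    (hfgh : ∀ x y, f x ^ t * g y ^ s ≤ h (t * x + s * y)) :
    (∫⁻ x, f x) ^ t * (∫⁻ x, g x) ^ s ≤ ∫⁻ x, h x := by
  have hsup : ∀ (F : ℝ → ℝ≥0∞) (n : ℕ), ⨆ x, min (F x) (n : ℝ≥0∞) ≠ ∞ := fun F n =>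
    ne_top_of_le_ne_top (ENNReal.natCast_ne_top n) (iSup_le fun x => min_le_right _ _)
  have key : ∀ m n : ℕ, (∫⁻ x, min (f x) m) ^ t * (∫⁻ x, min (g x) n) ^ s ≤ ∫⁻ x, h x :=
    fun m n => prekopaLeindler_of_iSup_ne_top ht hs hts (hf.min measurable_const)
      (hg.min measurable_const) hh (hsup f m) (hsup g n) fun x y =>
        (mul_le_mul' (ENNReal.rpow_le_rpow (min_le_left _ _) ht.le)
          (ENNReal.rpow_le_rpow (min_le_left _ _) hs.le)).trans (hfgh x y)
  rw [lintegral_eq_iSup_lintegral_min hf, lintegral_eq_iSup_lintegral_min hg]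
  -- Positive powers are order isomorphisms of `ℝ≥0∞`, so they commute with the suprema over
  -- truncations.
  have h1 := (ENNReal.orderIsoRpow t ht).map_iSup fun n : ℕ => ∫⁻ x, min (f x) n
  have h2 := (ENNReal.orderIsoRpow s hs).map_iSup fun n : ℕ => ∫⁻ x, min (g x) n
  simp only [ENNReal.orderIsoRpow_apply] at h1 h2
  rw [h1, h2, ENNReal.iSup_mul]
  refine iSup_le fun m => ?_
  rw [ENNReal.mul_iSup]
  exact iSup_le fun n => key m n

/-! ### Gaussian Prékopa–Leindler and its tensorization -/

/-- The identity `t x² + s y² = (t x + s y)² + t s (x - y)²` measures the strong log-concavity of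
the Gaussian density and is the source of the quadratic cost. -/
theorem gaussianPDF_rpow_mul_rpow {t s : ℝ} (hts : t + s = 1) (x y : ℝ) :
    gaussianPDF 0 1 x ^ t * gaussianPDF 0 1 y ^ s
        * ENNReal.ofReal (Real.exp (t * s * (x - y) ^ 2 / 2))
      = gaussianPDF 0 1 (t * x + s * y) := by
  have hpos : ∀ z, 0 < gaussianPDFReal 0 1 z := fun z => gaussianPDFReal_pos 0 1 z one_ne_zero
  simp only [gaussianPDF]
  rw [ENNReal.ofReal_rpow_of_pos (hpos x), ENNReal.ofReal_rpow_of_pos (hpos y),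
    ← ENNReal.ofReal_mul (Real.rpow_nonneg (hpos x).le _),
    ← ENNReal.ofReal_mul (mul_nonneg (Real.rpow_nonneg (hpos x).le _)
      (Real.rpow_nonneg (hpos y).le _))]
  congr 1
  simp only [gaussianPDFReal, NNReal.coe_one, mul_one, sub_zero]
  set c := (√(2 * Real.pi))⁻¹ with hc
  have hc0 : 0 < c := by positivity
  have hcc : c ^ t * c ^ s = c := by rw [← Real.rpow_add hc0, hts, Real.rpow_one]
  rw [Real.mul_rpow hc0.le (Real.exp_nonneg _), Real.mul_rpow hc0.le (Real.exp_nonneg _),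
    ← Real.exp_mul, ← Real.exp_mul, mul_mul_mul_comm, hcc, ← Real.exp_add, mul_assoc,
    ← Real.exp_add]
  congr 2
  obtain rfl : s = 1 - t := by linarith
  ring

/-- The Prékopa–Leindler inequality for the Gaussian measure on the line. -/
theorem gaussianReal_prekopaLeindler {t s : ℝ} (ht : 0 < t) (hs : 0 < s) (hts : t + s = 1)
    {f g : ℝ → ℝ≥0∞} (hf : Measurable f) (hg : Measurable g)
    (hfg : ∀ x y, f x ^ t * g y ^ s ≤ ENNReal.ofReal (Real.exp (t * s * (x - y) ^ 2 / 2))) :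
    (∫⁻ x, f x ∂gaussianReal 0 1) ^ t * (∫⁻ x, g x ∂gaussianReal 0 1) ^ s ≤ 1 := by
  have hφ := measurable_gaussianPDF 0 1
  rw [gaussianReal_of_var_ne_zero 0 one_ne_zero, lintegral_withDensity_eq_lintegral_mul _ hφ hf,
    lintegral_withDensity_eq_lintegral_mul _ hφ hg, ← lintegral_gaussianPDF_eq_one 0 one_ne_zero]
  refine prekopaLeindler ht hs hts (hφ.mul hf) (hφ.mul hg) hφ fun x y => ?_
  rw [← gaussianPDF_rpow_mul_rpow hts x y, Pi.mul_apply, Pi.mul_apply,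
    ENNReal.mul_rpow_of_nonneg _ _ ht.le, ENNReal.mul_rpow_of_nonneg _ _ hs.le, mul_mul_mul_comm]
  exact mul_le_mul_right (hfg x y) _

theorem measurable_finCons {n : ℕ} : Measurable fun p : ℝ × (Fin n → ℝ) =>
    (Fin.cons p.1 p.2 : Fin (n + 1) → ℝ) := by
  refine measurable_pi_lambda _ fun i => ?_
  refine Fin.cases ?_ (fun j => ?_) i
  · simpa using measurable_fst
  · simpa [Function.comp_def] using (measurable_pi_apply j).comp measurable_snd

theorem lintegral_pi_succ_eq {n : ℕ} (μ : Measure ℝ) [SigmaFinite μ]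
    {f : (Fin (n + 1) → ℝ) → ℝ≥0∞} (hf : Measurable f) :
    ∫⁻ x, f x ∂Measure.pi (fun _ => μ)
      = ∫⁻ a, ∫⁻ z, f (Fin.cons a z) ∂Measure.pi (fun _ : Fin n => μ) ∂μ := by
  have h := (measurePreserving_piFinSuccAbove (fun _ : Fin (n + 1) => μ) 0).symm
  rw [← lintegral_prod (fun p : ℝ × (Fin n → ℝ) => f (Fin.cons p.1 p.2))
    (hf.comp measurable_finCons).aemeasurable, ← h.lintegral_comp_emb (MeasurableEquiv.measurableEmbedding _)]
  refine lintegral_congr fun p => ?_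
  simp [MeasurableEquiv.piFinSuccAbove_symm_apply, Fin.insertNthEquiv]

/-- The Prékopa–Leindler inequality for the standard Gaussian measure on `ℝⁿ`. -/
theorem pi_gaussianReal_prekopaLeindler {t s : ℝ} (ht : 0 < t) (hs : 0 < s) (hts : t + s = 1)
    (n : ℕ) {f g : (Fin n → ℝ) → ℝ≥0∞} (hf : Measurable f) (hg : Measurable g)
    (hfg : ∀ x y, f x ^ t * g y ^ s
      ≤ ENNReal.ofReal (Real.exp (t * s * (∑ i, (x i - y i) ^ 2) / 2))) :
    (∫⁻ x, f x ∂Measure.pi fun _ => gaussianReal 0 1) ^ t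
      * (∫⁻ x, g x ∂Measure.pi fun _ => gaussianReal 0 1) ^ s ≤ 1 := by
  induction n with
  | zero =>
    have h : ∀ z, f z ^ t * g z ^ s ≤ 1 := fun z => (hfg z z).trans (by simp)
    simpa only [lintegral_unique, measure_univ, mul_one] using h _
  | succ n ih =>
    have hsec : ∀ a : ℝ, Measurable fun z : Fin n → ℝ => (Fin.cons a z : Fin (n + 1) → ℝ) :=
      fun a => measurable_finCons.comp measurable_prodMk_left
    rw [lintegral_pi_succ_eq _ hf, lintegral_pi_succ_eq _ hg]
    refine gaussianReal_prekopaLeindler ht hs hts (hf.comp measurable_finCons).lintegral_prod_right'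
      (hg.comp measurable_finCons).lintegral_prod_right' fun a b => ?_
    set k := Real.exp (t * s * (a - b) ^ 2 / 2) with hk
    have hk0 : 0 < k := Real.exp_pos _
    have hK0 : ENNReal.ofReal k ≠ 0 := (ENNReal.ofReal_pos.2 hk0).ne'
    have hKt : ENNReal.ofReal k ≠ ∞ := ENNReal.ofReal_ne_top
    -- The first coordinates contribute the factor `k` to the cost. Since `c ^ s = k⁻¹`, scaling the
    -- second section by `c` absorbs it, and the induction hypothesis yields the one-dimensional
    -- hypothesis with cost `k`.
    set c := (ENNReal.ofReal k)⁻¹ ^ s⁻¹ with hc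
    have hcs : c ^ s = (ENNReal.ofReal k)⁻¹ := by
      rw [hc, ← ENNReal.rpow_mul, inv_mul_cancel₀ hs.ne', ENNReal.rpow_one]
    have key := ih (hf.comp (hsec a)) ((hg.comp (hsec b)).const_mul c) (by
      intro x y
      have h := hfg (Fin.cons a x) (Fin.cons b y)
      rw [Fin.sum_univ_succ] at h
      simp only [Fin.cons_zero, Fin.cons_succ, mul_add, add_div, Real.exp_add] at h
      rw [ENNReal.ofReal_mul hk0.le] at h
      rw [ENNReal.mul_rpow_of_nonneg _ _ hs.le, hcs, mul_left_comm]
      calc _ ≤ (ENNReal.ofReal k)⁻¹ * (ENNReal.ofReal k * ENNReal.ofReal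
            (Real.exp (t * s * (∑ i, (x i - y i) ^ 2) / 2))) := mul_le_mul_right h _
        _ = _ := by rw [← mul_assoc, ENNReal.inv_mul_cancel hK0 hKt, one_mul])
    rw [lintegral_const_mul _ (hg.comp (hsec b)), ENNReal.mul_rpow_of_nonneg _ _ hs.le, hcs,
      mul_left_comm] at key
    calc _ = ENNReal.ofReal k * ((ENNReal.ofReal k)⁻¹ * _) := by
          rw [← mul_assoc, ENNReal.mul_inv_cancel hK0 hKt, one_mul]
          rfl
      _ ≤ ENNReal.ofReal k * 1 := mul_le_mul_right key _
      _ = _ := mul_one _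

/-- The Prékopa–Leindler inequality for the standard Gaussian measure on Euclidean space. -/
theorem stdGaussian_prekopaLeindler {n : ℕ} {t s : ℝ} (ht : 0 < t) (hs : 0 < s) (hts : t + s = 1)
    {f g : EuclideanSpace ℝ (Fin n) → ℝ≥0∞} (hf : Measurable f) (hg : Measurable g)
    (hfg : ∀ x y, f x ^ t * g y ^ s ≤ ENNReal.ofReal (Real.exp (t * s * ‖x - y‖ ^ 2 / 2))) :
    (∫⁻ x, f x ∂stdGaussian (EuclideanSpace ℝ (Fin n))) ^ t
      * (∫⁻ x, g x ∂stdGaussian (EuclideanSpace ℝ (Fin n))) ^ s ≤ 1 := by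
  have hm : Measurable (WithLp.toLp 2 : (Fin n → ℝ) → EuclideanSpace ℝ (Fin n)) := by fun_prop
  rw [← map_pi_eq_stdGaussian, lintegral_map hf hm, lintegral_map hg hm]
  refine pi_gaussianReal_prekopaLeindler ht hs hts n (hf.comp hm) (hg.comp hm) fun x y => ?_
  have h := hfg (WithLp.toLp 2 x) (WithLp.toLp 2 y)
  rw [EuclideanSpace.real_norm_sq_eq] at h
  simpa using h

/-! ### Transport inequality and exponential moments of squares -/

/-- Jensen for `exp`; in `ℝ≥0∞` the exponential need not be integrable, because the right side is
then infinite. -/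
theorem ofReal_exp_integral_le_lintegral_exp {α : Type*} [MeasurableSpace α] {μ : Measure α}
    [IsProbabilityMeasure μ] {g : α → ℝ} (hg : Integrable g μ) :
    ENNReal.ofReal (Real.exp (∫ x, g x ∂μ)) ≤ ∫⁻ x, ENNReal.ofReal (Real.exp (g x)) ∂μ := by
  by_cases hint : Integrable (fun x => Real.exp (g x)) μ
  · rw [← ofReal_integral_eq_lintegral_ofReal hint (ae_of_all _ fun x => (Real.exp_pos _).le)]
    exact ENNReal.ofReal_le_ofReal (convexOn_exp.map_integral_le Real.continuous_exp.continuousOn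
      isClosed_univ (by simp) hg hint)
  · have h : ∫⁻ x, ENNReal.ofReal (Real.exp (g x)) ∂μ = ∞ := by
      by_contra hne
      exact hint ((lintegral_ofReal_ne_top_iff_integrable
        (Real.continuous_exp.comp_aestronglyMeasurable hg.1)
        (ae_of_all _ fun x => (Real.exp_pos _).le)).1 hne)
    rw [h]
    exact le_top

/-- The dual form of Talagrand's transport inequality. -/
theorem lintegral_exp_le_of_le_add_sq {n : ℕ} {s : ℝ} (hs : 0 < s) (hs1 : s < 1)
    {u g : EuclideanSpace ℝ (Fin n) → ℝ} (hu : Measurable u) (hg : Measurable g)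
    (hgi : Integrable g (stdGaussian (EuclideanSpace ℝ (Fin n))))
    (hug : ∀ x y, u x ≤ g y + s * ‖x - y‖ ^ 2 / 2) :
    ∫⁻ x, ENNReal.ofReal (Real.exp (u x)) ∂stdGaussian (EuclideanSpace ℝ (Fin n))
      ≤ ENNReal.ofReal (Real.exp (∫ x, g x ∂stdGaussian (EuclideanSpace ℝ (Fin n)))) := by
  set γ := stdGaussian (EuclideanSpace ℝ (Fin n))
  set m := ∫ x, g x ∂γ with hm
  set t := 1 - s with ht
  have ht0 : 0 < t := by linarith
  have hts : t + s = 1 := by linarith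
  -- The factor `-(t/s)` makes the product of powers `exp(t (u x - g y))`, which the hypothesis
  -- bounds by the Gaussian cost. Jensen on the second factor then leaves `(∫ e^u)^t ≤ e^(t m)`.
  have hpl := stdGaussian_prekopaLeindler ht0 hs hts
    (f := fun x => ENNReal.ofReal (Real.exp (u x)))
    (g := fun y => ENNReal.ofReal (Real.exp (-(t / s) * g y)))
    hu.exp.ennreal_ofReal (hg.const_mul _).exp.ennreal_ofReal (by
      intro x y
      rw [ENNReal.ofReal_rpow_of_pos (Real.exp_pos _), ENNReal.ofReal_rpow_of_pos (Real.exp_pos _),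
        ← Real.exp_mul, ← Real.exp_mul, ← ENNReal.ofReal_mul (Real.exp_pos _).le, ← Real.exp_add]
      refine ENNReal.ofReal_le_ofReal (Real.exp_le_exp.2 ?_)
      have h := mul_le_mul_of_nonneg_left (hug x y) ht0.le
      have e : -(t / s) * g y * s = -(t * g y) := by field_simp
      rw [e]
      linarith)
  have hj := ofReal_exp_integral_le_lintegral_exp (hgi.const_mul (-(t / s)))
  rw [integral_const_mul, ← hm] at hj
  have h1 := (mul_le_mul_right (ENNReal.rpow_le_rpow hj hs.le) _).trans hpl
  rw [ENNReal.ofReal_rpow_of_pos (Real.exp_pos _), ← Real.exp_mul] at h1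
  have e : -(t / s) * m * s = -(m * t) := by field_simp
  rw [e, Real.exp_neg, ENNReal.ofReal_inv_of_pos (Real.exp_pos _), ← div_eq_mul_inv,
    ENNReal.div_le_iff (ENNReal.ofReal_pos.2 (Real.exp_pos _)).ne' ENNReal.ofReal_ne_top,
    one_mul, Real.exp_mul, ← ENNReal.ofReal_rpow_of_pos (Real.exp_pos _)] at h1
  exact (ENNReal.rpow_le_rpow_iff ht0).1 h1

/-- The exponential moments of the square of a Lipschitz function of a Gaussian vector. -/
theorem lintegral_exp_mul_sq_le {n : ℕ} {σ lam : ℝ} (hσ : 0 < σ) (hlam : 2 * σ ^ 2 * lam < 1)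
    {f : EuclideanSpace ℝ (Fin n) → ℝ} (hfm : Measurable f)
    (hf : ∀ x y, |f x - f y| ≤ σ * ‖x - y‖)
    (hfi : Integrable (fun x => f x ^ 2) (stdGaussian (EuclideanSpace ℝ (Fin n)))) :
    ∫⁻ x, ENNReal.ofReal (Real.exp (lam * f x ^ 2)) ∂stdGaussian (EuclideanSpace ℝ (Fin n))
      ≤ ENNReal.ofReal (Real.exp (lam / (1 - 2 * σ ^ 2 * lam)
          * ∫ x, f x ^ 2 ∂stdGaussian (EuclideanSpace ℝ (Fin n)))) := by
  set m := ∫ x, f x ^ 2 ∂stdGaussian (EuclideanSpace ℝ (Fin n)) with hm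
  -- The transport inequality needs `s < 1`; the sharp constant appears as `s → 1`.
  have hev : ∀ᶠ s : ℝ in 𝓝[<] 1,
      ∫⁻ x, ENNReal.ofReal (Real.exp (lam * f x ^ 2)) ∂stdGaussian (EuclideanSpace ℝ (Fin n))
        ≤ ENNReal.ofReal (Real.exp (lam * s / (s - 2 * σ ^ 2 * lam) * m)) := by
    filter_upwards [Ioo_mem_nhdsLT (show max 0 (2 * σ ^ 2 * lam) < 1 from max_lt one_pos hlam)]
      with s hs
    have hs0 : 0 < s := (le_max_left _ _).trans_lt hs.1
    have hk : 0 < s - 2 * σ ^ 2 * lam := sub_pos.2 ((le_max_right _ _).trans_lt hs.1)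
    rw [hm, ← integral_const_mul]
    refine lintegral_exp_le_of_le_add_sq hs0 hs.2 ((hfm.pow_const 2).const_mul _)
      ((hfm.pow_const 2).const_mul _) (hfi.const_mul _) fun x y => ?_
    have hd : (f x - f y) ^ 2 ≤ σ ^ 2 * ‖x - y‖ ^ 2 := by
      rw [← mul_pow, ← sq_abs]
      exact pow_le_pow_left₀ (abs_nonneg _) (hf x y) 2
    have hd' : s * (f x - f y) ^ 2 / (2 * σ ^ 2) ≤ s * ‖x - y‖ ^ 2 / 2 := by
      rw [div_le_div_iff₀ (by positivity) two_pos]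
      nlinarith
    refine le_trans ?_ (add_le_add_right hd' _)
    rw [← sub_nonneg]
    -- The coefficient of `f y ^ 2` is the one that turns the difference into a perfect square over
    -- a positive denominator.
    have e : lam * s / (s - 2 * σ ^ 2 * lam) * f y ^ 2 + s * (f x - f y) ^ 2 / (2 * σ ^ 2)
        - lam * f x ^ 2 = (s * f y - (s - 2 * σ ^ 2 * lam) * f x) ^ 2
          / (2 * σ ^ 2 * (s - 2 * σ ^ 2 * lam)) := by
      obtain ⟨k, rfl⟩ : ∃ k, s = k + 2 * σ ^ 2 * lam := ⟨s - 2 * σ ^ 2 * lam, by ring⟩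
      rw [add_sub_cancel_right] at hk ⊢
      field_simp
      ring
    rw [e]
    positivity
  have hlim : Tendsto (fun s : ℝ => ENNReal.ofReal
      (Real.exp (lam * s / (s - 2 * σ ^ 2 * lam) * m))) (𝓝[<] 1)
      (𝓝 (ENNReal.ofReal (Real.exp (lam * 1 / (1 - 2 * σ ^ 2 * lam) * m)))) := by
    refine tendsto_nhdsWithin_of_tendsto_nhds (ENNReal.tendsto_ofReal ?_)
    refine (Real.continuous_exp.tendsto _).comp (Tendsto.mul_const _ ?_)
    exact (tendsto_id.const_mul lam).div (tendsto_id.sub_const _) (by linarith)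
  simpa using ge_of_tendsto hlim hev

/-! ### From a sub-gamma moment generating function to variance and tails -/

/-- Squaring `y / 2 ≤ sinh (y / 2)` gives it. At `lam * Y` it turns exponential moments into second
moments, with constants that are exact as `lam → 0`. -/
theorem two_add_sq_le_exp_add_exp_neg (y : ℝ) : 2 + y ^ 2 ≤ Real.exp y + Real.exp (-y) := by
  wlog hy : 0 ≤ y generalizing y
  · have := this (-y) (by linarith)
    rw [neg_neg, neg_sq] at this
    linarith
  have h := Real.self_le_sinh_iff.2 (show 0 ≤ y / 2 by positivity)
  have h1 : Real.exp y = Real.exp (y / 2) ^ 2 := by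
    rw [← Real.exp_nat_mul]
    congr 1
    push_cast
    ring
  have h2 : Real.exp (-y) = Real.exp (-(y / 2)) ^ 2 := by
    rw [← Real.exp_nat_mul]
    congr 1
    push_cast
    ring
  have h3 : Real.exp (y / 2) * Real.exp (-(y / 2)) = 1 := by
    rw [← Real.exp_add, add_neg_cancel, Real.exp_zero]
  rw [Real.sinh_eq] at h
  have h4 : y ^ 2 ≤ (Real.exp (y / 2) - Real.exp (-(y / 2))) ^ 2 :=
    pow_le_pow_left₀ hy (by linarith) 2
  rw [h1, h2]
  nlinarith

theorem integrable_sq_of_integrable_exp {Ω : Type*} [MeasurableSpace Ω] {P : Measure Ω}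
    {Y : Ω → ℝ} (hY : AEStronglyMeasurable Y P) {lam : ℝ} (hlam : lam ≠ 0)
    (h1 : Integrable (fun ω => Real.exp (lam * Y ω)) P)
    (h2 : Integrable (fun ω => Real.exp (-lam * Y ω)) P) : Integrable (fun ω => Y ω ^ 2) P := by
  refine ((h1.add h2).const_mul (lam ^ 2)⁻¹).mono (hY.pow 2) (ae_of_all _ fun ω => ?_)
  have h := two_add_sq_le_exp_add_exp_neg (lam * Y ω)
  have hl : 0 < lam ^ 2 := by positivity
  rw [Real.norm_of_nonneg (sq_nonneg _), Real.norm_of_nonneg (by simp only [Pi.add_apply]; positivity),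
    inv_mul_eq_div, le_div_iff₀ hl, Pi.add_apply, neg_mul]
  nlinarith

section SubGamma

variable {Ω : Type*} [MeasurableSpace Ω] {P : Measure Ω} [IsProbabilityMeasure P] {Y : Ω → ℝ}
  {a c : ℝ}

/-- A sub-gamma bound on the moment generating function bounds the second moment. -/
theorem integral_sq_le_of_mgf_le (hY : AEStronglyMeasurable Y P) (hc : 0 < c) (ha : 0 ≤ a)
    (hint : ∀ lam, c * lam < 1 → Integrable (fun ω => Real.exp (lam * Y ω)) P)
    (hmgf : ∀ lam, c * lam < 1 →
      ∫ ω, Real.exp (lam * Y ω) ∂P ≤ Real.exp (a * lam ^ 2 / (1 - c * lam))) :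
    ∫ ω, Y ω ^ 2 ∂P ≤ 2 * a := by
  have hev : ∀ᶠ lam : ℝ in 𝓝[>] 0,
      ∫ ω, Y ω ^ 2 ∂P ≤ 2 * (a / (1 - c * lam)) * Real.exp (a * lam ^ 2 / (1 - c * lam)) := by
    filter_upwards [Ioo_mem_nhdsGT (show (0 : ℝ) < c⁻¹ by positivity)] with lam hl
    have hl0 : 0 < lam := hl.1
    have hcl : c * lam < 1 := by
      have := mul_lt_mul_of_pos_left hl.2 hc
      rwa [mul_inv_cancel₀ hc.ne'] at this
    have hcl' : c * -lam < 1 := by nlinarith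
    have hk : 0 < 1 - c * lam := by linarith
    have hsq := integrable_sq_of_integrable_exp hY hl0.ne' (hint _ hcl) (hint _ hcl')
    have h1 : ∫ ω, (2 + lam ^ 2 * Y ω ^ 2) ∂P
        ≤ ∫ ω, (Real.exp (lam * Y ω) + Real.exp (-lam * Y ω)) ∂P :=
      integral_mono ((integrable_const _).add (hsq.const_mul _))
        ((hint _ hcl).add (hint _ hcl')) fun ω => by
          have := two_add_sq_le_exp_add_exp_neg (lam * Y ω)
          rw [mul_pow] at this
          simpa [neg_mul] using this
    rw [integral_add (integrable_const _) (hsq.const_mul _), integral_const_mul,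
      integral_add (hint _ hcl) (hint _ hcl')] at h1
    simp only [integral_const, probReal_univ, one_smul] at h1
    have h2 := hmgf _ hcl
    have h3 := hmgf _ hcl'
    set z := a * lam ^ 2 / (1 - c * lam) with hz
    -- The bound at `-lam` is no larger than the one at `lam`, so both moments are at most `exp z`
    -- and `lam² E Y² ≤ 2 (exp z - 1)`.
    have h4 : a * (-lam) ^ 2 / (1 - c * -lam) ≤ z := by
      rw [hz, neg_sq]
      exact div_le_div_of_nonneg_left (by positivity) hk (by nlinarith)
    have h5 := h3.trans (Real.exp_le_exp.2 h4)
    have h6 : Real.exp z - 1 ≤ z * Real.exp z := by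
      have e1 := Real.add_one_le_exp (-z)
      have e2 : Real.exp (-z) * Real.exp z = 1 := by
        rw [← Real.exp_add, neg_add_cancel, Real.exp_zero]
      nlinarith [Real.exp_pos z]
    have h7 : lam ^ 2 * ∫ ω, Y ω ^ 2 ∂P ≤ lam ^ 2 * (2 * (a / (1 - c * lam)) * Real.exp z) := by
      have e : lam ^ 2 * (2 * (a / (1 - c * lam)) * Real.exp z) = 2 * (z * Real.exp z) := by
        rw [hz]
        ring
      rw [e]
      linarith
    exact le_of_mul_le_mul_left h7 (by positivity)
  have hlim : Tendsto (fun lam : ℝ => 2 * (a / (1 - c * lam))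
      * Real.exp (a * lam ^ 2 / (1 - c * lam))) (𝓝[>] 0)
      (𝓝 (2 * (a / (1 - c * 0)) * Real.exp (a * 0 ^ 2 / (1 - c * 0)))) := by
    refine tendsto_nhdsWithin_of_tendsto_nhds (ContinuousAt.tendsto ?_)
    have hne : (1 : ℝ) - c * 0 ≠ 0 := by simp
    fun_prop (disch := simpa using hne)
  simpa using ge_of_tendsto hlim hev

/-- Bernstein's tail bound for a variable with sub-gamma moment generating function. -/
theorem measureReal_abs_ge_le_of_mgf_le (hc : 0 < c) (ha : 0 ≤ a)
    (hint : ∀ lam, c * lam < 1 → Integrable (fun ω => Real.exp (lam * Y ω)) P)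
    (hmgf : ∀ lam, c * lam < 1 →
      ∫ ω, Real.exp (lam * Y ω) ∂P ≤ Real.exp (a * lam ^ 2 / (1 - c * lam))) {r : ℝ} (hr : 0 ≤ r) :
    P.real {ω | 2 * a * r + c * (a * r ^ 2) ≤ |Y ω|} ≤ 2 * Real.exp (-(a * r ^ 2)) := by
  set x := 2 * a * r + c * (a * r ^ 2) with hx
  have hcr : 0 < 1 + c * r := by positivity
  have hup : P.real {ω | x ≤ Y ω} ≤ Real.exp (-(a * r ^ 2)) := by
    -- With this `lam`, `1 - c lam = 1 / (1 + c r)` and the Chernoff exponent equals `-a r²`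
    -- exactly. The lower tail has slack, so `-r` suffices there.
    set lam := r / (1 + c * r) with hlam
    have hk : 1 - c * lam = 1 / (1 + c * r) := by
      rw [hlam]
      field_simp
      ring
    have hl : c * lam < 1 := by
      have : 0 < 1 - c * lam := by rw [hk]; positivity
      linarith
    refine (measure_ge_le_exp_mul_mgf x (by positivity) (hint lam hl)).trans ?_
    refine (mul_le_mul_of_nonneg_left (hmgf lam hl) (Real.exp_pos _).le).trans ?_
    rw [← Real.exp_add, hk, hlam, hx]
    refine (Real.exp_le_exp.2 (le_of_eq ?_))
    field_simp
    ring
  have hlow : P.real {ω | Y ω ≤ -x} ≤ Real.exp (-(a * r ^ 2)) := by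
    have hl : c * -r < 1 := by nlinarith
    refine (measure_le_le_exp_mul_mgf (-x) (by linarith) (hint (-r) hl)).trans ?_
    refine (mul_le_mul_of_nonneg_left (hmgf (-r) hl) (Real.exp_pos _).le).trans ?_
    rw [← Real.exp_add]
    refine Real.exp_le_exp.2 ?_
    have h1 : a * (-r) ^ 2 / (1 - c * -r) ≤ a * r ^ 2 := by
      rw [neg_sq]
      exact div_le_self (by positivity) (by nlinarith)
    have h2 : 0 ≤ r * (c * (a * r ^ 2)) := by positivity
    rw [hx]
    nlinarith
  calc P.real {ω | x ≤ |Y ω|} ≤ P.real ({ω | x ≤ Y ω} ∪ {ω | Y ω ≤ -x}) := by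
        refine measureReal_mono fun ω hω => ?_
        rcases le_abs.1 (Set.mem_ofPred_eq ▸ hω) with h | h
        · exact Or.inl h
        · exact Or.inr (by simp only [Set.mem_ofPred_eq]; linarith)
    _ ≤ _ := (measureReal_union_le _ _).trans (by linarith)

theorem measureReal_abs_ge_sqrt_le_of_mgf_le (hY : AEStronglyMeasurable Y P) (hc : 0 < c)
    (ha : 0 ≤ a) (hint : ∀ lam, c * lam < 1 → Integrable (fun ω => Real.exp (lam * Y ω)) P)
    (hmgf : ∀ lam, c * lam < 1 →
      ∫ ω, Real.exp (lam * Y ω) ∂P ≤ Real.exp (a * lam ^ 2 / (1 - c * lam))) {t : ℝ} (ht : 0 ≤ t) :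
    P.real {ω | √(4 * a * t) + c * t ≤ |Y ω|} ≤ 2 * Real.exp (-t) := by
  -- For `a > 0` take `r = √(t / a)`. For `a = 0` the second-moment bound forces `Y = 0` almost
  -- surely, so the event is null when `t > 0`, and for `t = 0` the bound is 2.
  rcases ha.eq_or_lt with rfl | ha'
  · rcases ht.eq_or_lt with rfl | ht'
    · refine measureReal_le_one.trans (by norm_num)
    have hl : c * (2 * c)⁻¹ < 1 := by
      rw [mul_inv, mul_left_comm, mul_inv_cancel₀ hc.ne']
      norm_num
    have hl' : c * -(2 * c)⁻¹ < 1 := by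
      rw [mul_neg, mul_inv, mul_left_comm, mul_inv_cancel₀ hc.ne']
      norm_num
    have hsq := integrable_sq_of_integrable_exp hY (by positivity) (hint _ hl) (hint _ hl')
    have h0 : ∫ ω, Y ω ^ 2 ∂P = 0 := le_antisymm
      (by simpa using integral_sq_le_of_mgf_le hY hc le_rfl hint hmgf)
      (integral_nonneg fun ω => sq_nonneg _)
    have hae := (integral_eq_zero_iff_of_nonneg (fun ω => sq_nonneg (Y ω)) hsq).1 h0
    have : P {ω | √(4 * 0 * t) + c * t ≤ |Y ω|} = 0 := by
      rw [← nonpos_iff_eq_zero, ← ae_iff.1 hae]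
      refine measure_mono fun ω hω => ?_
      have hpos : 0 < c * t := by positivity
      simp only [mul_zero, zero_mul, Real.sqrt_zero, zero_add, Set.mem_ofPred_eq] at hω
      simpa using abs_pos.1 (hpos.trans_le hω)
    rw [measureReal_def, this]
    simp [Real.exp_nonneg]
  · have h := measureReal_abs_ge_le_of_mgf_le hc ha hint hmgf (Real.sqrt_nonneg (t / a))
    have e1 : a * √(t / a) ^ 2 = t := by
      rw [Real.sq_sqrt (by positivity)]
      field_simp
    have e2 : √(4 * a * t) = 2 * a * √(t / a) := by
      rw [Real.sqrt_eq_iff_mul_self_eq (by positivity) (by positivity)]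
      linear_combination (-4 * a) * e1
    rwa [e1, ← e2] at h

end SubGamma

/-! ### Projections and the normalized displacement -/

section Projection

variable {n : ℕ} {K : Set (EuclideanSpace ℝ (Fin n))}

theorem IsProjOn.eq_convexProj (hne : K.Nonempty) (hcl : IsClosed K) (hcv : Convex ℝ K)
    {x p : EuclideanSpace ℝ (Fin n)} (hp : IsProjOn K x p) : p = convexProj K x :=
  (existsUnique_isProjOn hne hcl hcv x).unique hp (convexProj_spec hne hcl hcv x)

theorem convexProj_mem (hne : K.Nonempty) (hcl : IsClosed K) (hcv : Convex ℝ K)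
    (x : EuclideanSpace ℝ (Fin n)) : convexProj K x ∈ K :=
  (convexProj_spec hne hcl hcv x).1

theorem convexProj_eq_self (hne : K.Nonempty) (hcl : IsClosed K) (hcv : Convex ℝ K)
    {x : EuclideanSpace ℝ (Fin n)} (hx : x ∈ K) : convexProj K x = x :=
  (IsProjOn.eq_convexProj hne hcl hcv ⟨hx, fun q _ => by simp⟩).symm

theorem inner_sub_convexProj_le (hne : K.Nonempty) (hcl : IsClosed K) (hcv : Convex ℝ K)
    (x : EuclideanSpace ℝ (Fin n)) {q : EuclideanSpace ℝ (Fin n)} (hq : q ∈ K) :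
    inner ℝ (x - convexProj K x) (q - convexProj K x) ≤ 0 := by
  obtain ⟨v, hv, hmin⟩ := exists_norm_eq_iInf_of_complete_convex hne hcl.isComplete hcv x
  have hvar := (norm_eq_iInf_iff_real_inner_le_zero hcv hv).1 hmin
  have hproj : IsProjOn K x v := by
    refine ⟨hv, fun w hw => ?_⟩
    have h1 := hvar w hw
    have h2 := norm_sub_sq_real (x - v) (w - v)
    rw [sub_sub_sub_cancel_right] at h2
    nlinarith [sq_nonneg ‖w - v‖]
  rw [← hproj.eq_convexProj hne hcl hcv]
  exact hvar q hq

/-- Quantitative uniqueness of the minimizer: a nearly optimal point of `K` is close to the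
projection. The low-noise limit relies on this. -/
theorem norm_sq_sub_convexProj_add_le (hne : K.Nonempty) (hcl : IsClosed K) (hcv : Convex ℝ K)
    (x : EuclideanSpace ℝ (Fin n)) {q : EuclideanSpace ℝ (Fin n)} (hq : q ∈ K) :
    ‖x - convexProj K x‖ ^ 2 + ‖q - convexProj K x‖ ^ 2 ≤ ‖x - q‖ ^ 2 := by
  have h1 := inner_sub_convexProj_le hne hcl hcv x hq
  have h2 := norm_sub_sq_real (x - convexProj K x) (q - convexProj K x)
  rw [sub_sub_sub_cancel_right] at h2
  linarith

theorem norm_convexProj_sub_le (hne : K.Nonempty) (hcl : IsClosed K) (hcv : Convex ℝ K)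
    (x y : EuclideanSpace ℝ (Fin n)) : ‖convexProj K x - convexProj K y‖ ≤ ‖x - y‖ := by
  set p := convexProj K x
  set q := convexProj K y
  have h1 := inner_sub_convexProj_le hne hcl hcv x (convexProj_mem hne hcl hcv y)
  have h2 := inner_sub_convexProj_le hne hcl hcv y (convexProj_mem hne hcl hcv x)
  have h3 : ‖p - q‖ ^ 2 ≤ inner ℝ (x - y) (p - q) := by
    rw [← real_inner_self_eq_norm_sq, ← sub_nonneg, ← inner_sub_left]
    have e : inner ℝ (x - y - (p - q)) (p - q)
        = -inner ℝ (x - p) (q - p) - inner ℝ (y - q) (p - q) := by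
      rw [← neg_sub p q, inner_neg_right, neg_neg, ← inner_sub_left]
      congr 1
      abel
    rw [e]
    linarith
  have h4 := h3.trans (real_inner_le_norm _ _)
  by_contra! hlt
  nlinarith [norm_nonneg (x - y)]

theorem continuous_convexProj (hne : K.Nonempty) (hcl : IsClosed K) (hcv : Convex ℝ K) :
    Continuous (convexProj K) :=
  (LipschitzWith.of_dist_le_mul (K := 1) fun x y => by
    simpa [dist_eq_norm] using norm_convexProj_sub_le hne hcl hcv x y).continuous

theorem continuous_seqErr (hne : K.Nonempty) (hcl : IsClosed K) (hcv : Convex ℝ K)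
    (μ : EuclideanSpace ℝ (Fin n)) (σ : ℝ) : Continuous (seqErr K μ σ) := by
  have := continuous_convexProj hne hcl hcv
  unfold seqErr seqLSE
  fun_prop

/-- Puts `scaledProjRisk` in the framework of `seqErr`. As `0` need not lie in `K`, the lemmas on
which this route relies allow an arbitrary base point. -/
theorem seqErr_zero (σ : ℝ) (x : EuclideanSpace ℝ (Fin n)) :
    seqErr K 0 σ x = ‖convexProj K (σ • x)‖ ^ 2 := by
  simp [seqErr, seqLSE]

/-- The normalized displacement `‖Π_K(μ + σ x) - μ‖ / σ` decreases with `σ`. -/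
theorem mul_norm_seqLSE_sub_le (hne : K.Nonempty) (hcl : IsClosed K) (hcv : Convex ℝ K)
    (μ x : EuclideanSpace ℝ (Fin n)) {s t : ℝ} (hs : 0 < s) (hst : s ≤ t) :
    s * ‖seqLSE K μ t x - μ‖ ≤ t * ‖seqLSE K μ s x - μ‖ := by
  set a := seqLSE K μ s x - μ with ha
  set b := seqLSE K μ t x - μ with hb
  have ht : 0 < t := hs.trans_le hst
  have h1 : inner ℝ (s • x - a) (b - a) ≤ 0 := by
    have h := inner_sub_convexProj_le hne hcl hcv (μ + s • x)
      (convexProj_mem hne hcl hcv (μ + t • x))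
    have e1 : μ + s • x - convexProj K (μ + s • x) = s • x - a := by
      rw [ha, seqLSE]
      abel
    have e2 : convexProj K (μ + t • x) - convexProj K (μ + s • x) = b - a := by
      rw [ha, hb, seqLSE, seqLSE]
      abel
    rwa [e1, e2] at h
  have h2 : inner ℝ (t • x - b) (a - b) ≤ 0 := by
    have h := inner_sub_convexProj_le hne hcl hcv (μ + t • x)
      (convexProj_mem hne hcl hcv (μ + s • x))
    have e1 : μ + t • x - convexProj K (μ + t • x) = t • x - b := by
      rw [hb, seqLSE]
      abel
    have e2 : convexProj K (μ + s • x) - convexProj K (μ + t • x) = a - b := by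
      rw [ha, hb, seqLSE, seqLSE]
      abel
    rwa [e1, e2] at h
  simp only [inner_sub_left, inner_sub_right, real_inner_smul_left, real_inner_self_eq_norm_sq]
    at h1 h2
  rw [real_inner_comm a b] at h2
  -- Weighting the inequalities by `t` and `s` cancels the terms in `x`.
  have h3 : s * ‖b‖ ^ 2 + t * ‖a‖ ^ 2 ≤ (s + t) * inner ℝ a b := by
    nlinarith [mul_le_mul_of_nonneg_left h1 ht.le, mul_le_mul_of_nonneg_left h2 hs.le]
  have h4 : (s + t) * inner ℝ a b ≤ (s + t) * (‖a‖ * ‖b‖) :=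
    mul_le_mul_of_nonneg_left (real_inner_le_norm a b) (by linarith)
  by_contra! hlt
  have h5 : ‖a‖ < ‖b‖ := by
    by_contra! hba
    nlinarith [mul_le_mul_of_nonneg_right hst (norm_nonneg a),
      mul_le_mul_of_nonneg_left hba hs.le]
  nlinarith [mul_pos (sub_pos.2 hlt) (sub_pos.2 h5)]

theorem seqErr_div_eq (μ x : EuclideanSpace ℝ (Fin n)) (σ : ℝ) :
    seqErr K μ σ x / σ ^ 2 = (‖seqLSE K μ σ x - μ‖ / σ) ^ 2 := by
  rw [div_pow, seqErr]

theorem antitoneOn_seqErr_div (hne : K.Nonempty) (hcl : IsClosed K) (hcv : Convex ℝ K)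
    (μ x : EuclideanSpace ℝ (Fin n)) :
    AntitoneOn (fun σ : ℝ => seqErr K μ σ x / σ ^ 2) (Set.Ioi 0) := by
  intro s hs t ht hst
  simp only [Set.mem_Ioi] at hs ht
  simp only [seqErr_div_eq]
  refine pow_le_pow_left₀ (by positivity) ?_ 2
  rw [div_le_div_iff₀ ht hs, mul_comm _ s, mul_comm _ t]
  exact mul_norm_seqLSE_sub_le hne hcl hcv μ x hs hst

theorem exists_tendsto_of_antitoneOn_of_nonneg {f : ℝ → ℝ} (hf : AntitoneOn f (Set.Ioi 0))
    (hf0 : ∀ r, 0 ≤ f r) : ∃ l, Tendsto f atTop (𝓝 l) ∧ ∀ r, 0 < r → l ≤ f r := by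
  -- Monotonicity is known only for positive arguments; `max r 1` extends it to the whole line
  -- without changing the limit.
  have hanti : Antitone fun r => f (max r 1) := fun r s hrs =>
    hf (Set.mem_Ioi.2 (by positivity)) (Set.mem_Ioi.2 (by positivity))
      (max_le_max_right 1 hrs)
  have hlim := tendsto_atTop_ciInf hanti ⟨0, by rintro _ ⟨r, rfl⟩; exact hf0 _⟩
  have hlim' : Tendsto f atTop (𝓝 (⨅ r, f (max r 1))) := by
    refine hlim.congr' ?_
    filter_upwards [eventually_ge_atTop 1] with r hr
    rw [max_eq_left hr]
  refine ⟨_, hlim', fun r hr => le_of_tendsto hlim' ?_⟩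
  filter_upwards [eventually_ge_atTop r] with s hs
  exact hf hr (hr.trans_le hs) hs

theorem norm_seqLSE_sub_le (hne : K.Nonempty) (hcl : IsClosed K) (hcv : Convex ℝ K)
    (μ x : EuclideanSpace ℝ (Fin n)) {σ : ℝ} (hσ : 0 < σ) :
    ‖seqLSE K μ σ x - μ‖ ≤ σ * ‖x‖ + ‖convexProj K μ - μ‖ := by
  have h := norm_convexProj_sub_le hne hcl hcv (μ + σ • x) μ
  rw [add_sub_cancel_left, norm_smul, Real.norm_of_nonneg hσ.le] at h
  have := norm_sub_le_norm_sub_add_norm_sub (seqLSE K μ σ x) (convexProj K μ) μ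
  rw [seqLSE] at *
  linarith

theorem abs_norm_seqLSE_sub_sub_le (hne : K.Nonempty) (hcl : IsClosed K) (hcv : Convex ℝ K)
    (μ x y : EuclideanSpace ℝ (Fin n)) {σ : ℝ} (hσ : 0 < σ) :
    |‖seqLSE K μ σ x - μ‖ - ‖seqLSE K μ σ y - μ‖| ≤ σ * ‖x - y‖ := by
  refine (abs_norm_sub_norm_le _ _).trans ?_
  rw [sub_sub_sub_cancel_right, seqLSE, seqLSE]
  refine (norm_convexProj_sub_le hne hcl hcv _ _).trans (le_of_eq ?_)
  rw [add_sub_add_left_eq_sub, ← smul_sub, norm_smul, Real.norm_of_nonneg hσ.le]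

theorem integrable_norm_add_const_sq (b c : ℝ) :
    Integrable (fun x => (c * ‖x‖ + b) ^ 2) (stdGaussian (EuclideanSpace ℝ (Fin n))) := by
  have h : MemLp (fun x : EuclideanSpace ℝ (Fin n) => c * ‖x‖ + b) 2
      (stdGaussian (EuclideanSpace ℝ (Fin n))) :=
    ((IsGaussian.memLp_id _ 2 (by norm_num)).norm.const_mul c).add (memLp_const b)
  exact h.integrable_sq

theorem integrable_seqErr (hne : K.Nonempty) (hcl : IsClosed K) (hcv : Convex ℝ K)
    (μ : EuclideanSpace ℝ (Fin n)) {σ : ℝ} (hσ : 0 < σ) :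
    Integrable (seqErr K μ σ) (stdGaussian (EuclideanSpace ℝ (Fin n))) := by
  refine (integrable_norm_add_const_sq ‖convexProj K μ - μ‖ σ).mono'
    (continuous_seqErr hne hcl hcv μ σ).aestronglyMeasurable (ae_of_all _ fun x => ?_)
  rw [seqErr, Real.norm_of_nonneg (sq_nonneg _)]
  exact pow_le_pow_left₀ (norm_nonneg _) (norm_seqLSE_sub_le hne hcl hcv μ x hσ) 2

theorem seqErr_div_le (hne : K.Nonempty) (hcl : IsClosed K) (hcv : Convex ℝ K)
    {μ : EuclideanSpace ℝ (Fin n)} (hμ : μ ∈ K) (x : EuclideanSpace ℝ (Fin n)) {σ : ℝ}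
    (hσ : 0 < σ) : seqErr K μ σ x / σ ^ 2 ≤ ‖x‖ ^ 2 := by
  have h := norm_seqLSE_sub_le hne hcl hcv μ x hσ
  rw [convexProj_eq_self hne hcl hcv hμ, sub_self, norm_zero, add_zero] at h
  rw [seqErr_div_eq]
  refine pow_le_pow_left₀ (by positivity) ?_ 2
  rwa [div_le_iff₀ hσ, mul_comm]

/-- The normalized displacement has the same high-noise limit for all base points. -/
theorem tendsto_norm_seqLSE_div_sub (hne : K.Nonempty) (hcl : IsClosed K) (hcv : Convex ℝ K)
    (μ x : EuclideanSpace ℝ (Fin n)) :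
    Tendsto (fun σ : ℝ => ‖seqLSE K μ σ x - μ‖ / σ - ‖convexProj K (σ • x)‖ / σ) atTop (𝓝 0) := by
  -- One `‖μ‖` comes from shifting the projected point, the other from subtracting the base point.
  have hlim : Tendsto (fun σ : ℝ => 2 * ‖μ‖ / σ) atTop (𝓝 0) :=
    tendsto_const_nhds.div_atTop tendsto_id
  refine squeeze_zero_norm' ?_ hlim
  filter_upwards [eventually_gt_atTop 0] with σ hσ
  rw [← sub_div, norm_div, Real.norm_of_nonneg hσ.le, Real.norm_eq_abs]
  gcongr
  refine (abs_norm_sub_norm_le _ _).trans ?_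
  have h := norm_convexProj_sub_le hne hcl hcv (μ + σ • x) (σ • x)
  rw [add_sub_cancel_right] at h
  have e : seqLSE K μ σ x - μ - convexProj K (σ • x)
      = convexProj K (μ + σ • x) - convexProj K (σ • x) - μ := by
    rw [seqLSE]
    abel
  rw [e]
  exact (norm_sub_le _ _).trans (by linarith)

theorem exists_tendsto_seqErr_div (hne : K.Nonempty) (hcl : IsClosed K) (hcv : Convex ℝ K)
    (μ x : EuclideanSpace ℝ (Fin n)) : ∃ l : ℝ,
      Tendsto (fun σ : ℝ => ‖convexProj K (σ • x)‖ ^ 2 / σ ^ 2) atTop (𝓝 l) ∧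
      Tendsto (fun σ : ℝ => seqErr K μ σ x / σ ^ 2) atTop (𝓝 l) ∧
      ∀ σ : ℝ, 0 < σ → l ≤ seqErr K μ σ x / σ ^ 2 := by
  obtain ⟨l, hl, hle⟩ := exists_tendsto_of_antitoneOn_of_nonneg
    (antitoneOn_seqErr_div hne hcl hcv μ x) fun σ => by
      rw [seqErr_div_eq]
      positivity
  refine ⟨l, ?_, hl, hle⟩
  have hsqrt : Tendsto (fun σ : ℝ => ‖seqLSE K μ σ x - μ‖ / σ) atTop (𝓝 √l) := by
    refine hl.sqrt.congr' ?_
    filter_upwards [eventually_gt_atTop 0] with σ hσ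
    rw [seqErr_div_eq, Real.sqrt_sq (by positivity)]
  have h := (hsqrt.sub (tendsto_norm_seqLSE_div_sub hne hcl hcv μ x)).pow 2
  have hl0 : 0 ≤ l := ge_of_tendsto hl (Eventually.of_forall fun σ => by
    rw [seqErr_div_eq]
    positivity)
  rw [sub_zero, Real.sq_sqrt hl0] at h
  refine h.congr fun σ => ?_
  rw [sub_sub_cancel, div_pow]

end Projection

/-! ### The tangent cone and the low-noise limit -/

section TangentCone

variable {n : ℕ} {K : Set (EuclideanSpace ℝ (Fin n))} {μ₀ : EuclideanSpace ℝ (Fin n)}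

theorem smul_sub_mem_tangentConeOf {α : ℝ} (hα : 0 ≤ α) {ν : EuclideanSpace ℝ (Fin n)}
    (hν : ν ∈ K) : α • (ν - μ₀) ∈ tangentConeOf K μ₀ :=
  subset_closure ⟨α, hα, ν, hν, rfl⟩

theorem tangentConeOf_nonempty (hne : K.Nonempty) : (tangentConeOf K μ₀).Nonempty := by
  obtain ⟨ν, hν⟩ := hne
  exact ⟨_, smul_sub_mem_tangentConeOf zero_le_one hν⟩

theorem isClosed_tangentConeOf : IsClosed (tangentConeOf K μ₀) := isClosed_closure

theorem convex_tangentConeOf (hcv : Convex ℝ K) : Convex ℝ (tangentConeOf K μ₀) := by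
  refine Convex.closure ?_
  rintro _ ⟨α, hα, ν, hν, rfl⟩ _ ⟨β, hβ, ξ, hξ, rfl⟩ a b ha hb -
  have h1 : 0 ≤ a * α := mul_nonneg ha hα
  have h2 : 0 ≤ b * β := mul_nonneg hb hβ
  -- If both weights vanish the combination is zero; otherwise normalizing them gives a convex
  -- combination in `K`.
  rcases (add_nonneg h1 h2).eq_or_lt with h0 | h0
  · have e1 : a * α = 0 := by linarith
    have e2 : b * β = 0 := by linarith
    exact ⟨0, le_rfl, ν, hν, by rw [smul_smul, smul_smul, e1, e2]; simp⟩
  · refine ⟨a * α + b * β, h0.le, (a * α / (a * α + b * β)) • ν + (b * β / (a * α + b * β)) • ξ,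
      hcv hν hξ (by positivity) (by positivity) (by field_simp), ?_⟩
    match_scalars <;> field_simp
    ring

theorem smul_mem_tangentConeOf {c : ℝ} (hc : 0 ≤ c) {v : EuclideanSpace ℝ (Fin n)}
    (hv : v ∈ tangentConeOf K μ₀) : c • v ∈ tangentConeOf K μ₀ := by
  refine map_mem_closure (continuous_const_smul c) hv ?_
  rintro _ ⟨α, hα, ν, hν, rfl⟩
  exact ⟨c * α, mul_nonneg hc hα, ν, hν, smul_smul _ _ _⟩

theorem convexProj_tangentConeOf_smul (hne : K.Nonempty) (hcv : Convex ℝ K) {σ : ℝ} (hσ : 0 < σ)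
    (x : EuclideanSpace ℝ (Fin n)) :
    convexProj (tangentConeOf K μ₀) (σ • x) = σ • convexProj (tangentConeOf K μ₀) x := by
  have hT := tangentConeOf_nonempty (μ₀ := μ₀) hne
  have hTcl := isClosed_tangentConeOf (K := K) (μ₀ := μ₀)
  have hTcv := convex_tangentConeOf (μ₀ := μ₀) hcv
  refine (IsProjOn.eq_convexProj hT hTcl hTcv
    ⟨smul_mem_tangentConeOf hσ.le (convexProj_mem hT hTcl hTcv x), fun q hq => ?_⟩).symm
  have h := (convexProj_spec hT hTcl hTcv x).2 _
    (smul_mem_tangentConeOf (inv_nonneg.2 hσ.le) hq)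
  have e : σ • x - q = σ • (x - σ⁻¹ • q) := by
    rw [smul_sub, smul_smul, mul_inv_cancel₀ hσ.ne', one_smul]
  rw [e, ← smul_sub, norm_smul, norm_smul, mul_pow, mul_pow]
  exact mul_le_mul_of_nonneg_left h (sq_nonneg _)

/-- At low noise the normalized displacement converges to the projection on the tangent cone. -/
theorem tendsto_seqErr_div_nhdsGT_zero (hne : K.Nonempty) (hcl : IsClosed K) (hcv : Convex ℝ K)
    (hμ : μ₀ ∈ K) (x : EuclideanSpace ℝ (Fin n)) :
    Tendsto (fun σ : ℝ => seqErr K μ₀ σ x / σ ^ 2) (𝓝[>] 0)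
      (𝓝 (‖convexProj (tangentConeOf K μ₀) x‖ ^ 2)) := by
  have hT := tangentConeOf_nonempty (μ₀ := μ₀) hne
  have hTcl := isClosed_tangentConeOf (K := K) (μ₀ := μ₀)
  have hTcv := convex_tangentConeOf (μ₀ := μ₀) hcv
  set z := convexProj (tangentConeOf K μ₀) x with hz
  have hzmem : z ∈ tangentConeOf K μ₀ := convexProj_mem hT hTcl hTcv x
  have hsq : Tendsto (fun σ : ℝ => ‖σ⁻¹ • (seqLSE K μ₀ σ x - μ₀) - z‖ ^ 2) (𝓝[>] 0) (𝓝 0) := by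
    rw [tendsto_order]
    refine ⟨fun a ha => Eventually.of_forall fun σ => ha.trans_le (sq_nonneg _), fun ε hε => ?_⟩
    have hcont : Tendsto (fun w => ‖x - w‖ ^ 2 - ‖x - z‖ ^ 2) (𝓝 z) (𝓝 0) := by
      have : Continuous fun w => ‖x - w‖ ^ 2 - ‖x - z‖ ^ 2 := by fun_prop
      simpa using this.tendsto z
    -- An almost optimal `α (ν - μ₀)` in the cone before closure is a competitor for the estimator
    -- once `σ α ≤ 1`. The rescaled displacement lies in the cone and is then also almost optimal,
    -- hence close to `z`.
    obtain ⟨_, ⟨α, hα, ν, hν, rfl⟩, hw⟩ :=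
      ((mem_closure_iff_frequently.1 hzmem).and_eventually (hcont.eventually_lt_const hε)).exists
    filter_upwards [Ioo_mem_nhdsGT (show (0 : ℝ) < (α + 1)⁻¹ by positivity)] with σ hσ
    have hσ0 : 0 < σ := hσ.1
    have hσα : σ * α ≤ 1 := by
      have h := mul_lt_mul_of_pos_right hσ.2 (show 0 < α + 1 by linarith)
      rw [inv_mul_cancel₀ (by linarith)] at h
      nlinarith
    have hmem : μ₀ + (σ * α) • (ν - μ₀) ∈ K :=
      hcv.add_smul_sub_mem hμ hν ⟨mul_nonneg hσ0.le hα, hσα⟩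
    have h1 := (convexProj_spec hne hcl hcv (μ₀ + σ • x)).2 _ hmem
    have e1 : μ₀ + σ • x - convexProj K (μ₀ + σ • x)
        = σ • (x - σ⁻¹ • (seqLSE K μ₀ σ x - μ₀)) := by
      rw [smul_sub, smul_smul, mul_inv_cancel₀ hσ0.ne', one_smul, seqLSE]
      abel
    have e2 : μ₀ + σ • x - (μ₀ + (σ * α) • (ν - μ₀)) = σ • (x - α • (ν - μ₀)) := by
      module
    rw [e1, e2, norm_smul, norm_smul, mul_pow, mul_pow] at h1
    have h2 := le_of_mul_le_mul_left h1 (pow_pos (norm_pos_iff.2 hσ0.ne') 2)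
    have h3 := norm_sq_sub_convexProj_add_le hT hTcl hTcv x
      (smul_sub_mem_tangentConeOf (μ₀ := μ₀) (inv_nonneg.2 hσ0.le)
        (convexProj_mem hne hcl hcv (μ₀ + σ • x)))
    rw [← hz] at h3
    rw [seqLSE] at *
    linarith
  have hnorm : Tendsto (fun σ : ℝ => ‖σ⁻¹ • (seqLSE K μ₀ σ x - μ₀) - z‖) (𝓝[>] 0) (𝓝 0) := by
    simpa using hsq.sqrt
  refine ((tendsto_iff_norm_sub_tendsto_zero.2 hnorm).norm.pow 2).congr' ?_
  filter_upwards [self_mem_nhdsWithin] with σ hσ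
  rw [seqErr_div_eq, norm_smul, norm_inv, Real.norm_of_nonneg (le_of_lt hσ), inv_mul_eq_div]

end TangentCone

/-! ### Limits of the risk and the sub-gamma bound for the error -/

section Risk

variable {n : ℕ} {K : Set (EuclideanSpace ℝ (Fin n))}

/-- Dominated convergence for the high-noise risk. -/
theorem exists_tendsto_risk (hne : K.Nonempty) (hcl : IsClosed K) (hcv : Convex ℝ K)
    (μ : EuclideanSpace ℝ (Fin n)) : ∃ l : EuclideanSpace ℝ (Fin n) → ℝ,
      (∀ x, Tendsto (fun σ : ℝ => ‖convexProj K (σ • x)‖ ^ 2 / σ ^ 2) atTop (𝓝 (l x))) ∧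
      Tendsto (fun σ : ℝ => (∫ x, seqErr K μ σ x ∂stdGaussian (EuclideanSpace ℝ (Fin n))) / σ ^ 2)
        atTop (𝓝 (∫ x, l x ∂stdGaussian (EuclideanSpace ℝ (Fin n)))) := by
  choose l hl hlerr hle using exists_tendsto_seqErr_div hne hcl hcv μ
  refine ⟨l, hl, ?_⟩
  simp only [← integral_div]
  refine tendsto_integral_filter_of_dominated_convergence
    (fun x => (1 * ‖x‖ + ‖convexProj K μ - μ‖) ^ 2) (Eventually.of_forall fun σ =>
      ((continuous_seqErr hne hcl hcv μ σ).div_const _).aestronglyMeasurable) ?_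
    (integrable_norm_add_const_sq _ _) (ae_of_all _ hlerr)
  -- For `σ ≥ 1` dividing by `σ` does not enlarge the offset `‖convexProj K μ - μ‖`, so the
  -- dominating function is free of `σ`.
  filter_upwards [eventually_ge_atTop 1] with σ hσ
  refine ae_of_all _ fun x => ?_
  have hσ0 : 0 < σ := by linarith
  rw [seqErr_div_eq, Real.norm_of_nonneg (sq_nonneg _)]
  refine pow_le_pow_left₀ (by positivity) ?_ 2
  rw [div_le_iff₀ hσ0]
  have h := norm_seqLSE_sub_le hne hcl hcv μ x hσ0
  nlinarith [norm_nonneg (convexProj K μ - μ)]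

theorem scaledProjRisk_eq (σ : ℝ) : scaledProjRisk K σ
    = (∫ x, seqErr K 0 σ x ∂stdGaussian (EuclideanSpace ℝ (Fin n))) / σ ^ 2 := by
  simp only [scaledProjRisk, seqErr_zero]

/-- `limUnder` is meaningful only once a limit is known to exist; dominated convergence with base
point zero supplies it. -/
theorem tendsto_scaledProjRisk (hne : K.Nonempty) (hcl : IsClosed K) (hcv : Convex ℝ K) :
    Tendsto (scaledProjRisk K) atTop (𝓝 (genStatDim K)) := by
  obtain ⟨l, -, h⟩ := exists_tendsto_risk hne hcl hcv 0
  simp only [← scaledProjRisk_eq] at h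
  rw [genStatDim, Tendsto.limUnder_eq h]
  exact h

theorem tendsto_risk_atTop (hne : K.Nonempty) (hcl : IsClosed K) (hcv : Convex ℝ K)
    (μ : EuclideanSpace ℝ (Fin n)) :
    Tendsto (fun σ : ℝ => (∫ x, seqErr K μ σ x ∂stdGaussian (EuclideanSpace ℝ (Fin n))) / σ ^ 2)
      atTop (𝓝 (genStatDim K)) := by
  obtain ⟨l, hl, h⟩ := exists_tendsto_risk hne hcl hcv 0
  obtain ⟨l', hl', h'⟩ := exists_tendsto_risk hne hcl hcv μ
  -- Both functions are the pathwise limit of `‖convexProj K (σ • x)‖² / σ²`, which does not involve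
  -- the base point.
  obtain rfl : l = l' := funext fun x => tendsto_nhds_unique (hl x) (hl' x)
  simp only [← scaledProjRisk_eq] at h
  rwa [tendsto_nhds_unique (tendsto_scaledProjRisk hne hcl hcv) h]

theorem integrable_norm_convexProj_sq (hne : K.Nonempty) (hcl : IsClosed K) (hcv : Convex ℝ K)
    {σ : ℝ} (hσ : 0 < σ) : Integrable (fun x => ‖convexProj K (σ • x)‖ ^ 2)
      (stdGaussian (EuclideanSpace ℝ (Fin n))) := by
  simpa only [← seqErr_zero] using integrable_seqErr hne hcl hcv 0 hσ

/-- Projection on a closed convex cone is positively homogeneous, so the scaled risk is constant for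
`σ > 0`. -/
theorem genStatDim_tangentConeOf (hne : K.Nonempty) (hcv : Convex ℝ K)
    (μ₀ : EuclideanSpace ℝ (Fin n)) : genStatDim (tangentConeOf K μ₀)
      = ∫ x, ‖convexProj (tangentConeOf K μ₀) x‖ ^ 2 ∂stdGaussian (EuclideanSpace ℝ (Fin n)) := by
  refine tendsto_nhds_unique (tendsto_scaledProjRisk (tangentConeOf_nonempty hne)
    isClosed_tangentConeOf (convex_tangentConeOf hcv)) (tendsto_const_nhds.congr' ?_)
  filter_upwards [eventually_gt_atTop 0] with σ hσ
  simp only [scaledProjRisk, convexProj_tangentConeOf_smul hne hcv hσ, norm_smul, mul_pow,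
    integral_const_mul, Real.norm_of_nonneg hσ.le]
  rw [mul_div_cancel_left₀ _ (by positivity)]

theorem tendsto_risk_nhdsGT_zero (hne : K.Nonempty) (hcl : IsClosed K) (hcv : Convex ℝ K)
    {μ₀ : EuclideanSpace ℝ (Fin n)} (hμ : μ₀ ∈ K) :
    Tendsto (fun σ : ℝ => (∫ x, seqErr K μ₀ σ x ∂stdGaussian (EuclideanSpace ℝ (Fin n))) / σ ^ 2)
      (𝓝[>] 0) (𝓝 (genStatDim (tangentConeOf K μ₀))) := by
  rw [genStatDim_tangentConeOf hne hcv]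
  simp only [← integral_div]
  refine tendsto_integral_filter_of_dominated_convergence
    (fun x => (1 * ‖x‖ + 0) ^ 2) (Eventually.of_forall fun σ =>
      ((continuous_seqErr hne hcl hcv μ₀ σ).div_const _).aestronglyMeasurable) ?_
    (integrable_norm_add_const_sq _ _)
    (ae_of_all _ (tendsto_seqErr_div_nhdsGT_zero hne hcl hcv hμ))
  filter_upwards [self_mem_nhdsWithin] with σ hσ
  refine ae_of_all _ fun x => ?_
  have h := seqErr_div_le hne hcl hcv hμ x hσ
  rw [Real.norm_of_nonneg (by rw [seqErr_div_eq]; positivity)]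
  simpa using h

theorem antitoneOn_risk_div (hne : K.Nonempty) (hcl : IsClosed K) (hcv : Convex ℝ K)
    (μ : EuclideanSpace ℝ (Fin n)) : AntitoneOn (fun σ : ℝ =>
      (∫ x, seqErr K μ σ x ∂stdGaussian (EuclideanSpace ℝ (Fin n))) / σ ^ 2) (Set.Ioi 0) := by
  intro s hs t ht hst
  simp only [← integral_div]
  exact integral_mono ((integrable_seqErr hne hcl hcv μ ht).div_const _)
    ((integrable_seqErr hne hcl hcv μ hs).div_const _)
    fun x => antitoneOn_seqErr_div hne hcl hcv μ x hs ht hst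

/-- The two sides are the limits at infinity and at zero of one nonincreasing function, the
normalized risk at `μ₀`. -/
theorem genStatDim_le_genStatDim_tangentConeOf (hne : K.Nonempty) (hcl : IsClosed K)
    (hcv : Convex ℝ K) {μ₀ : EuclideanSpace ℝ (Fin n)} (hμ : μ₀ ∈ K) :
    genStatDim K ≤ genStatDim (tangentConeOf K μ₀) := by
  refine ge_of_tendsto (tendsto_risk_nhdsGT_zero hne hcl hcv hμ) ?_
  filter_upwards [self_mem_nhdsWithin] with σ hσ
  refine le_of_tendsto (tendsto_risk_atTop hne hcl hcv μ₀) ?_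
  filter_upwards [eventually_ge_atTop σ] with τ hτ
  exact antitoneOn_risk_div hne hcl hcv μ₀ hσ ((Set.mem_Ioi.1 hσ).trans_le hτ) hτ

/-- The squared error of the projection estimator is sub-gamma. -/
theorem integrable_exp_and_integral_exp_le (hne : K.Nonempty) (hcl : IsClosed K)
    (hcv : Convex ℝ K) (μ : EuclideanSpace ℝ (Fin n)) {σ lam : ℝ} (hσ : 0 < σ)
    (hlam : 2 * σ ^ 2 * lam < 1) {m : ℝ}
    (hm : m = ∫ x, seqErr K μ σ x ∂stdGaussian (EuclideanSpace ℝ (Fin n))) :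
    Integrable (fun x => Real.exp (lam * (seqErr K μ σ x - m)))
        (stdGaussian (EuclideanSpace ℝ (Fin n))) ∧
      ∫ x, Real.exp (lam * (seqErr K μ σ x - m)) ∂stdGaussian (EuclideanSpace ℝ (Fin n))
        ≤ Real.exp (2 * σ ^ 2 * m * lam ^ 2 / (1 - 2 * σ ^ 2 * lam)) := by
  have hcont := continuous_seqErr hne hcl hcv μ σ
  have hfm : Measurable fun x => ‖seqLSE K μ σ x - μ‖ := by
    have := continuous_convexProj hne hcl hcv
    unfold seqLSE
    exact Continuous.measurable (by fun_prop)
  have h := lintegral_exp_mul_sq_le hσ hlam hfm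
    (fun x y => abs_norm_seqLSE_sub_sub_le hne hcl hcv μ x y hσ)
    (integrable_seqErr hne hcl hcv μ hσ)
  change ∫⁻ x, ENNReal.ofReal (Real.exp (lam * seqErr K μ σ x)) ∂_
    ≤ ENNReal.ofReal (Real.exp (lam / (1 - 2 * σ ^ 2 * lam) * ∫ x, seqErr K μ σ x ∂_)) at h
  rw [← hm] at h
  have hpos : ∀ x, 0 ≤ Real.exp (lam * seqErr K μ σ x) := fun x => (Real.exp_pos _).le
  have hint : Integrable (fun x => Real.exp (lam * seqErr K μ σ x))
      (stdGaussian (EuclideanSpace ℝ (Fin n))) :=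
    (lintegral_ofReal_ne_top_iff_integrable
      (Real.continuous_exp.comp (hcont.const_mul lam)).aestronglyMeasurable
      (ae_of_all _ hpos)).1 (ne_top_of_le_ne_top ENNReal.ofReal_ne_top h)
  rw [← ofReal_integral_eq_lintegral_ofReal hint (ae_of_all _ hpos),
    ENNReal.ofReal_le_ofReal_iff (Real.exp_pos _).le] at h
  -- Centering replaces `lam m / (1 - c lam)` by `lam m / (1 - c lam) - lam m = c m lam² / (1 - c
  -- lam)`, where `c = 2σ²`.
  have e : ∀ x, Real.exp (lam * (seqErr K μ σ x - m))
      = Real.exp (-(lam * m)) * Real.exp (lam * seqErr K μ σ x) := fun x => by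
    rw [← Real.exp_add]
    congr 1
    ring
  simp only [e]
  refine ⟨hint.const_mul _, ?_⟩
  rw [integral_const_mul]
  refine (mul_le_mul_of_nonneg_left h (Real.exp_pos _).le).trans ?_
  rw [← Real.exp_add]
  refine Real.exp_le_exp.2 (le_of_eq ?_)
  have hk : 1 - 2 * σ ^ 2 * lam ≠ 0 := by linarith
  obtain ⟨k, hk'⟩ : ∃ k, k = 1 - 2 * σ ^ 2 * lam := ⟨_, rfl⟩
  rw [← hk'] at hk ⊢
  field_simp
  rw [hk']
  ring

end Risk

/-! ### Assembly, for noise on an arbitrary probability space -/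

theorem proposition4p3 {n : ℕ} (K : Set (EuclideanSpace ℝ (Fin n))) (hKne : K.Nonempty)
    (hKcl : IsClosed K) (hKcv : Convex ℝ K) (μ₀ : EuclideanSpace ℝ (Fin n))
    {Ω : Type*} [MeasurableSpace Ω] (P : Measure Ω) [IsProbabilityMeasure P]
    (h : Ω → EuclideanSpace ℝ (Fin n))
    (hh : HasLaw h (stdGaussian (EuclideanSpace ℝ (Fin n))) P) :
    -- (1), for a signal `μ₀ ∈ K`
    (μ₀ ∈ K →
      -- pathwise: the high-noise limit exists, bounds `err(σ)/σ²` below, and is attained at `∞`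
      (∀ x : EuclideanSpace ℝ (Fin n), ∃ l : ℝ,
        Tendsto (fun σ : ℝ => ‖convexProj K (σ • x)‖ ^ 2 / σ ^ 2) atTop (𝓝 l) ∧
        (∀ σ : ℝ, 0 < σ → l ≤ seqErr K μ₀ σ x / σ ^ 2 ∧ seqErr K μ₀ σ x / σ ^ 2 ≤ ‖x‖ ^ 2) ∧
        Tendsto (fun σ : ℝ => seqErr K μ₀ σ x / σ ^ 2) atTop (𝓝 l)) ∧
      -- the limits that define `δ_K` and `δ_{T_K(μ₀)}` are genuine
      (∀ σ : ℝ, 0 < σ → Integrable (fun x => ‖convexProj K (σ • x)‖ ^ 2)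
        (stdGaussian (EuclideanSpace ℝ (Fin n)))) ∧
      Tendsto (scaledProjRisk K) atTop (𝓝 (genStatDim K)) ∧
      (∀ σ : ℝ, 0 < σ → Integrable (fun x => ‖convexProj (tangentConeOf K μ₀) (σ • x)‖ ^ 2)
        (stdGaussian (EuclideanSpace ℝ (Fin n)))) ∧
      Tendsto (scaledProjRisk (tangentConeOf K μ₀)) atTop
        (𝓝 (genStatDim (tangentConeOf K μ₀))) ∧
      -- the high- and low-noise limits of the normalized risk
      Tendsto (fun σ : ℝ => (∫ ω, seqErr K μ₀ σ (h ω) ∂P) / σ ^ 2) atTop (𝓝 (genStatDim K)) ∧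
      Tendsto (fun σ : ℝ => (∫ ω, seqErr K μ₀ σ (h ω) ∂P) / σ ^ 2) (𝓝[>] 0)
        (𝓝 (genStatDim (tangentConeOf K μ₀))) ∧
      genStatDim K ≤ genStatDim (tangentConeOf K μ₀)) ∧
    -- (2) the variance bound
    (∀ σ : ℝ, 0 < σ →
      MemLp (fun ω => seqErr K μ₀ σ (h ω)) 2 P ∧
      variance (fun ω => seqErr K μ₀ σ (h ω)) P
        ≤ 4 * σ ^ 2 * ∫ ω, seqErr K μ₀ σ (h ω) ∂P) ∧
    -- (3) the moment generating function bound and the tail bound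
    (∀ σ : ℝ, 0 < σ →
      (∀ lam : ℝ, lam < 1 / (2 * σ ^ 2) →
        Integrable (fun ω => Real.exp (lam *
          (seqErr K μ₀ σ (h ω) - ∫ ω', seqErr K μ₀ σ (h ω') ∂P))) P ∧
        ∫ ω, Real.exp (lam * (seqErr K μ₀ σ (h ω) - ∫ ω', seqErr K μ₀ σ (h ω') ∂P)) ∂P
          ≤ Real.exp (2 * σ ^ 2 * lam ^ 2 * (∫ ω, seqErr K μ₀ σ (h ω) ∂P)
              / (1 - 2 * σ ^ 2 * lam))) ∧
      (∀ t : ℝ, 0 ≤ t →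
        P.real {ω | Real.sqrt (8 * σ ^ 2 * (∫ ω', seqErr K μ₀ σ (h ω') ∂P) * t) + 2 * σ ^ 2 * t
            ≤ |seqErr K μ₀ σ (h ω) - ∫ ω', seqErr K μ₀ σ (h ω') ∂P|}
          ≤ 2 * Real.exp (-t))) := by
  have hrisk : ∀ σ : ℝ, ∫ ω, seqErr K μ₀ σ (h ω) ∂P
      = ∫ x, seqErr K μ₀ σ x ∂stdGaussian (EuclideanSpace ℝ (Fin n)) := fun σ =>
    hh.integral_comp (continuous_seqErr hKne hKcl hKcv μ₀ σ).aestronglyMeasurable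
  have hmeas : ∀ σ : ℝ, AEStronglyMeasurable (fun ω => seqErr K μ₀ σ (h ω)) P := fun σ =>
    ((continuous_seqErr hKne hKcl hKcv μ₀ σ).measurable.comp_aemeasurable
      hh.aemeasurable).aestronglyMeasurable
  have hmgf : ∀ σ : ℝ, 0 < σ → ∀ lam : ℝ, 2 * σ ^ 2 * lam < 1 →
      Integrable (fun ω => Real.exp (lam *
        (seqErr K μ₀ σ (h ω) - ∫ ω', seqErr K μ₀ σ (h ω') ∂P))) P ∧
      ∫ ω, Real.exp (lam * (seqErr K μ₀ σ (h ω) - ∫ ω', seqErr K μ₀ σ (h ω') ∂P)) ∂P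
        ≤ Real.exp (2 * σ ^ 2 * (∫ ω, seqErr K μ₀ σ (h ω) ∂P) * lam ^ 2
            / (1 - 2 * σ ^ 2 * lam)) := by
    intro σ hσ lam hlam
    obtain ⟨h1, h2⟩ := integrable_exp_and_integral_exp_le hKne hKcl hKcv μ₀ hσ hlam (hrisk σ)
    refine ⟨(hh.map_eq.symm ▸ h1).comp_aemeasurable hh.aemeasurable, ?_⟩
    rw [← hh.integral_comp h1.aestronglyMeasurable] at h2
    exact h2
  have hrisk0 : ∀ σ : ℝ, 0 ≤ 2 * σ ^ 2 * ∫ ω, seqErr K μ₀ σ (h ω) ∂P := fun σ =>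
    mul_nonneg (by positivity) (integral_nonneg fun ω => sq_nonneg _)
  refine ⟨fun hμ => ⟨fun x => ?_, fun σ hσ => integrable_norm_convexProj_sq hKne hKcl hKcv hσ,
    tendsto_scaledProjRisk hKne hKcl hKcv,
    fun σ hσ => integrable_norm_convexProj_sq (tangentConeOf_nonempty hKne)
      isClosed_tangentConeOf (convex_tangentConeOf hKcv) hσ,
    tendsto_scaledProjRisk (tangentConeOf_nonempty hKne) isClosed_tangentConeOf
      (convex_tangentConeOf hKcv), ?_, ?_,
    genStatDim_le_genStatDim_tangentConeOf hKne hKcl hKcv hμ⟩, fun σ hσ => ?_,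
    fun σ hσ => ⟨fun lam hlam => ?_, fun t ht => ?_⟩⟩
  · obtain ⟨l, h1, h2, h3⟩ := exists_tendsto_seqErr_div hKne hKcl hKcv μ₀ x
    exact ⟨l, h1, fun σ hσ => ⟨h3 σ hσ, seqErr_div_le hKne hKcl hKcv hμ x hσ⟩, h2⟩
  · simpa only [hrisk] using tendsto_risk_atTop hKne hKcl hKcv μ₀
  · simpa only [hrisk] using tendsto_risk_nhdsGT_zero hKne hKcl hKcv hμ
  · have hσ2 : 0 < σ ^ 2 := by positivity
    have hY := (hmeas σ).sub (aestronglyMeasurable_const (b := ∫ ω, seqErr K μ₀ σ (h ω) ∂P))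
    -- Half of the critical value `1 / (2σ²)`, so that `lam` and `-lam` are both admissible.
    have hsq := integrable_sq_of_integrable_exp hY (lam := (4 * σ ^ 2)⁻¹) (by positivity)
      (hmgf σ hσ _ (by field_simp; norm_num)).1 (hmgf σ hσ _ (by
        have : 0 < (4 * σ ^ 2)⁻¹ := by positivity
        nlinarith)).1
    have hmem : MemLp (fun ω => seqErr K μ₀ σ (h ω)) 2 P := by
      have h2 := ((memLp_two_iff_integrable_sq hY).2 hsq).add
        (memLp_const (∫ ω, seqErr K μ₀ σ (h ω) ∂P))
      refine h2.ae_eq (ae_of_all _ fun ω => ?_)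
      simp
    refine ⟨hmem, ?_⟩
    rw [variance_eq_integral (hmeas σ).aemeasurable]
    refine (integral_sq_le_of_mgf_le hY (by positivity) (hrisk0 σ)
      (fun lam hl => (hmgf σ hσ lam hl).1) fun lam hl => (hmgf σ hσ lam hl).2).trans (le_of_eq ?_)
    ring
  · rw [lt_div_iff₀ (by positivity)] at hlam
    have h1 := hmgf σ hσ lam (by linarith)
    rwa [mul_right_comm (2 * σ ^ 2)] at h1
  · have hY := (hmeas σ).sub (aestronglyMeasurable_const (b := ∫ ω, seqErr K μ₀ σ (h ω) ∂P))
    have h1 := measureReal_abs_ge_sqrt_le_of_mgf_le hY (by positivity) (hrisk0 σ)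
      (fun lam hl => (hmgf σ hσ lam hl).1) (fun lam hl => (hmgf σ hσ lam hl).2) ht
    have e : 4 * (2 * σ ^ 2 * ∫ ω, seqErr K μ₀ σ (h ω) ∂P)
        = 8 * σ ^ 2 * ∫ ω, seqErr K μ₀ σ (h ω) ∂P := by ring
    rwa [e] at h1
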